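/- A \emph{pathograph} $\mathfrak{G}$ is a 6-tuple $(V,U,E,S,R,\pi)$ with a finite set $V$ of vertices, a finite set $U$ of urpaths, a set $E\subseteq\binom{V}{2}$ of edges, a set $S\subseteq V\times U$ of spokes, a set $R\subseteq\binom{U}{2}$ of rungs, and a map $\pi:U\to\binom{V}{2}$ sending each urpath to its two endpoints, such that $\pi(u)\notin E$ for all $u\in U$. A \emph{realization} of $\mathfrak{G}$ is a graph $G$ obtained by replacing each urpath $u$, with endpoints $a,b$, by an induced path $a\,x_u^{(1)}\cdots x_u^{(m_u)}\,b$ with $m_u\ge 1$ new internal vertices, so that: two vertices of $V$ are adjacent in $G$ if and only if they form an edge in $E$; for $u\in U$ and $v\in V\setminus\pi(u)$, the vertex $v$ is adjacent in $G$ to some $x_u^{(k)}$ if and only if $(v,u)\in S$; and for distinct $u,u'\in U$, some $x_u^{(k)}$ is adjacent in $G$ to some $x_{u'}^{(\ell)}$ if and only if $\{u,u'\}\in R$. A graph \emph{contains} a pathograph $\mathfrak{F}$ if one of its induced subgraphs is isomorphic to a realization of $\mathfrak{F}$; for a set $\mathcal{F}$ of pathographs, a graph is \emph{$\mathcal{F}$-free}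 if it contains no $\mathfrak{F}\in\mathcal{F}$. \textbf{Theorem.} The following problem is decidable: given a pathograph $\mathfrak{H}$ with no rungs (spokes are allowed) and a finite set $\mathcal{F}$ of pathographs (whose members may have rungs), is there an $\mathcal{F}$-free realization of $\mathfrak{H}$? That is, there is one algorithm which, on every input $(\mathfrak{H},\mathcal{F})$ of this kind, given by finite lists, halts and answers this question correctly. -/

import Mathlib

/-- A pathograph `(V, U, E, S, R, π)`: finite sets `V` of vertices and `U` of urpaths, a set `E`
of edges (2-subsets of `V`, i.e. a simple graph on `V`), a set `S ⊆ V × U` of spokes, a set `R`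
of rungs (2-subsets of `U`, i.e. a simple graph on `U`), and a map `π` that sends each urpath to
its two distinct endpoints, which are not joined by an edge. -/
structure Pathograph where
  /-- the vertices -/
  V : Type
  /-- the urpaths -/
  U : Type
  finite_V : Finite V
  finite_U : Finite U
  /-- the edges -/
  edges : SimpleGraph V
  /-- the spokes -/
  Spoke : V → U → Prop
  /-- the rungs -/
  rungs : SimpleGraph U
  /-- the endpoints of an urpath -/
  ends : U → Sym2 V
  ends_not_isDiag : ∀ u, ¬ (ends u).IsDiag
  ends_not_mem_edges : ∀ u, ends u ∉ edges.edgeSet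

namespace Pathograph

/-- The pathograph has no rungs. -/
def Rungless (H : Pathograph) : Prop := H.rungs = ⊥

/-- `G` is obtained from `H` by replacing each urpath `u`, with endpoints `a, b`, by an induced
path `a, x₀, …, x_{m u - 1}, b` with `m u ≥ 1` new internal vertices `x_i = Sum.inr ⟨u, i⟩`.
Adjacencies between the old vertices are kept.  A vertex that is not an endpoint of `u` has a
neighbour among the internal vertices of the path of `u` exactly if it forms a spoke with `u`,
and the internal vertices of the paths of two different urpaths are joined by some edge exactly
if the two urpaths form a rung.  (The adjacencies of the endpoints of `u` to the internal vertices
of its path are prescribed by the path being induced.) -/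
structure IsSubdivision (H : Pathograph) (m : H.U → ℕ)
    (G : SimpleGraph (H.V ⊕ (Σ u : H.U, Fin (m u)))) : Prop where
  one_le : ∀ u, 1 ≤ m u
  edge : ∀ v w : H.V, G.Adj (Sum.inl v) (Sum.inl w) ↔ H.edges.Adj v w
  internal : ∀ (u : H.U) (i j : Fin (m u)),
    G.Adj (Sum.inr ⟨u, i⟩) (Sum.inr ⟨u, j⟩) ↔ (i : ℕ) + 1 = j ∨ (j : ℕ) + 1 = i
  endpoints : ∀ u : H.U, ∃ a b : H.V, H.ends u = s(a, b) ∧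
    (∀ i : Fin (m u), G.Adj (Sum.inl a) (Sum.inr ⟨u, i⟩) ↔ (i : ℕ) = 0) ∧
    (∀ i : Fin (m u), G.Adj (Sum.inl b) (Sum.inr ⟨u, i⟩) ↔ (i : ℕ) + 1 = m u)
  spoke : ∀ (v : H.V) (u : H.U), v ∉ H.ends u →
    (H.Spoke v u ↔ ∃ i : Fin (m u), G.Adj (Sum.inl v) (Sum.inr ⟨u, i⟩))
  rung : ∀ u u' : H.U, u ≠ u' →
    (H.rungs.Adj u u' ↔
      ∃ (i : Fin (m u)) (j : Fin (m u')), G.Adj (Sum.inr ⟨u, i⟩) (Sum.inr ⟨u', j⟩))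

/-- The graph `G` is (isomorphic to) a realization of `H`. -/
def IsRealization (H : Pathograph) {W : Type} (G : SimpleGraph W) : Prop :=
  ∃ (m : H.U → ℕ) (G' : SimpleGraph (H.V ⊕ (Σ u : H.U, Fin (m u)))),
    H.IsSubdivision m G' ∧ Nonempty (G ≃g G')

/-- The graph `G` contains `F`: some induced subgraph of `G` is a realization of `F`. -/
def ContainedIn (F : Pathograph) {W : Type} (G : SimpleGraph W) : Prop :=
  ∃ s : Set W, F.IsRealization (G.induce s)

/-- `H` has a realization that contains no member of `𝓕`. -/
def HasFreeRealization (H : Pathograph) (𝓕 : List Pathograph) : Prop :=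
  ∃ (W : Type) (G : SimpleGraph W), H.IsRealization G ∧ ∀ F ∈ 𝓕, ¬ F.ContainedIn G

/-- Finite descriptions of pathographs as inputs of algorithms: the number of vertices, the list
of the pairs of endpoints of the urpaths, and the lists of edges, spokes and rungs, where
vertices and urpaths are given by their indices. -/
abbrev Code : Type :=
  ℕ × List (ℕ × ℕ) × List (ℕ × ℕ) × List (ℕ × ℕ) × List (ℕ × ℕ)

/-- The code describes the pathograph `H`, for some numbering of the vertices and urpaths. -/
def IsCodeOf : Code → Pathograph → Prop
  | (n, ends, edges, spokes, rungs), H =>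
    ∃ (eV : H.V ≃ Fin n) (eU : H.U ≃ Fin ends.length),
      (∀ u, (H.ends u).map (fun v => (eV v : ℕ)) =
        s((ends.get (eU u)).1, (ends.get (eU u)).2)) ∧
      (∀ v w, H.edges.Adj v w ↔
        ((eV v : ℕ), (eV w : ℕ)) ∈ edges ∨ ((eV w : ℕ), (eV v : ℕ)) ∈ edges) ∧
      (∀ v u, H.Spoke v u ↔ ((eV v : ℕ), (eU u : ℕ)) ∈ spokes) ∧
      (∀ u u', H.rungs.Adj u u' ↔
        ((eU u : ℕ), (eU u' : ℕ)) ∈ rungs ∨ ((eU u' : ℕ), (eU u : ℕ)) ∈ rungs)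

/-- Every pathograph has a code. -/
theorem exists_isCodeOf (H : Pathograph) : ∃ c : Code, IsCodeOf c H := by
  classical
  have := H.finite_V
  have := H.finite_U
  obtain ⟨n, ⟨eV⟩⟩ := Finite.exists_equiv_fin H.V
  obtain ⟨k, ⟨eU⟩⟩ := Finite.exists_equiv_fin H.U
  have key : ∀ {a b : ℕ} (p : Fin a → Fin b → Prop),
      ∃ l : List (ℕ × ℕ), ∀ i j, p i j ↔ ((i : ℕ), (j : ℕ)) ∈ l := by
    intro a b p
    refine ⟨((Finset.univ.filter (fun q : Fin a × Fin b => p q.1 q.2)).image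
      (fun q => ((q.1 : ℕ), (q.2 : ℕ)))).toList, fun i j => ?_⟩
    simp only [Finset.mem_toList, Finset.mem_image, Finset.mem_filter, Finset.mem_univ, true_and,
      Prod.mk.injEq, Prod.exists]
    constructor
    · exact fun h => ⟨i, j, h, rfl, rfl⟩
    · rintro ⟨i', j', h, hi, hj⟩
      rwa [← Fin.ext hi, ← Fin.ext hj]
  obtain ⟨l₁, h₁⟩ := key (fun i j => H.edges.Adj (eV.symm i) (eV.symm j))
  obtain ⟨l₂, h₂⟩ := key (fun i j => H.Spoke (eV.symm i) (eU.symm j))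
  obtain ⟨l₃, h₃⟩ := key (fun i j => H.rungs.Adj (eU.symm i) (eU.symm j))
  refine ⟨(n, List.ofFn (fun j => (fun p : H.V × H.V => ((eV p.1 : ℕ), (eV p.2 : ℕ)))
    (Quot.out (H.ends (eU.symm j)))), l₁, l₂, l₃), eV,
    eU.trans (finCongr (by simp)), ?_, ?_, ?_, ?_⟩
  · intro u
    have h : (s((Quot.out (H.ends u)).1, (Quot.out (H.ends u)).2) : Sym2 H.V) = H.ends u :=
      Quot.out_eq _
    have h' : (H.ends u).map (fun v => (eV v : ℕ)) =
        s((eV (Quot.out (H.ends u)).1 : ℕ), (eV (Quot.out (H.ends u)).2 : ℕ)) := by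
      conv_lhs => rw [← h]
      rfl
    rw [h']
    simp
  · intro v w
    rw [← h₁, ← h₁]
    simp [H.edges.adj_comm w v]
  · intro v u
    have := h₂ (eV v) (eU u)
    simpa using this
  · intro u u'
    have a := h₃ (eU u) (eU u')
    have b := h₃ (eU u') (eU u)
    simp only [Equiv.symm_apply_apply] at a b
    simp only [Equiv.trans_apply, finCongr_apply, Fin.val_cast]
    rw [← a, ← b, H.rungs.adj_comm u' u, or_self]

end Pathograph

/-! The proof bounds the size of a smallest solution by pumping on words; the algorithm is then an
exhaustive search below that bound.

Containment is expressed by quantifying over labellings and vertex sets. A copy of a pathograph in a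
graph is a labelling of the vertices: one label for each vertex of the pathograph, one for the
interior of each urpath, and spare labels for the rest. Most conditions only ask whether some vertex
or some edge with given labels exists. The exception is that the interior of an urpath be an induced
path. This is replaced by minimality: the interior connects the two ends, and no longer does so
after removal of any nonempty subset. A shortest path through a minimal connecting set uses all of
it, so such a set is an induced path. Both conditions quantify over sets `D` and `Q` only, which
gives `IsModel`.

A realization of a rungless pathograph is the graph of a word over a finite alphabet: the vertices
are listed path by path, and each internal vertex records its urpath and its neighbours in `V`. In
the absence of rungs every remaining edge joins consecutive positions of one path
(`Rungless.exists_wordGraph`).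

For such graphs, `IsModel` with `D` and `Q` fixed depends only on the letters and the pairs of
consecutive letters. Each quantifier over sets or labellings is absorbed by passing to the set of
invariants of all colourings, which keeps the invariant finite and compatible with adding a letter
in front. A shortest word with a given invariant has suffixes with pairwise different invariants, so
it is shorter than the number of invariants (`IsCongruence.exists_short`). Being a realization of
`H` and containing a member of `𝓕` are both read off the invariant, so a solution can be replaced by
one of explicitly bounded size. The members of `𝓕` may have rungs, since only the graph searched,
not the pattern, has to be a word.

Graphs, labellings and sets on `n` vertices are coded by digits of bounded numbers, so the search is
primitive recursive. -/

namespace SimpleGraph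

/-! ### Induced paths as minimal connecting sets -/

variable {W : Type*} {G : SimpleGraph W}

/-- A minimal set connecting two non-adjacent vertices `a` and `b` is an induced path. -/
theorem exists_inducedPath_of_minimal {I : Set W} {a b : W} (hab : a ≠ b)
    (hadj : ¬ G.Adj a b) (ha : a ∉ I) (hb : b ∉ I)
    (hconn : ∀ D : Set W, a ∈ D → b ∉ D →
      ∃ i ∈ insert a (insert b I), ∃ j ∈ insert a (insert b I), i ∈ D ∧ j ∉ D ∧ G.Adj i j)
    (hmin : ∀ D : Set W, (∃ i ∈ I, i ∈ D) → ∃ Q : Set W, a ∈ Q ∧ b ∉ Q ∧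
      ∀ i ∈ insert a (insert b I), ∀ j ∈ insert a (insert b I), i ∈ Q → j ∉ Q →
        ¬ (i ∈ I ∧ i ∈ D) → ¬ (j ∈ I ∧ j ∈ D) → ¬ G.Adj i j) :
    ∃ (m : ℕ) (p : Fin m → W), 1 ≤ m ∧ Function.Injective p ∧ Set.range p = I ∧
      (∀ i j, G.Adj (p i) (p j) ↔ (i : ℕ) + 1 = j ∨ (j : ℕ) + 1 = i) ∧
      (∀ i, G.Adj a (p i) ↔ (i : ℕ) = 0) ∧ (∀ i, G.Adj b (p i) ↔ (i : ℕ) + 1 = m) := by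
  classical
  set X : Set W := insert a (insert b I) with hX
  have haX : a ∈ X := by simp [hX]
  have hbX : b ∈ X := by simp [hX]
  set G' := G.induce X with hG'
  have hr : G'.Reachable ⟨a, haX⟩ ⟨b, hbX⟩ := by
    by_contra hcon
    -- The test set is the component of `a`, which no edge leaves.
    obtain ⟨i, hi, j, hj, ⟨_, hiD⟩, hjD, hij⟩ :=
      hconn {x | ∃ h : x ∈ X, G'.Reachable ⟨a, haX⟩ ⟨x, h⟩} ⟨haX, .refl _⟩
        (fun ⟨_, h⟩ => hcon h)
    exact hjD ⟨hj, hiD.trans (SimpleGraph.Adj.reachable (by simpa [hG'] using hij))⟩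
  -- On a shortest walk the `i`-th vertex has distance `i` from `a`; hence the vertices are
  -- distinct, and only consecutive ones are adjacent.
  obtain ⟨w, hw⟩ := hr.exists_walk_length_eq_dist
  set ℓ := w.length with hℓ
  have hdist : ∀ i ≤ ℓ, G'.dist ⟨a, haX⟩ (w.getVert i) = i := by
    intro i hi
    have h1 : G'.dist ⟨a, haX⟩ (w.getVert i) ≤ i := by
      refine (SimpleGraph.dist_le (w.take i)).trans ?_
      simp [SimpleGraph.Walk.take_length]
    obtain ⟨q, hq⟩ := (w.take i).reachable.exists_walk_length_eq_dist
    have h2 := SimpleGraph.dist_le (q.append (w.drop i))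
    rw [SimpleGraph.Walk.length_append, SimpleGraph.Walk.drop_length] at h2
    omega
  have hsucc : ∀ i < ℓ, G'.Adj (w.getVert i) (w.getVert (i + 1)) :=
    fun i hi => w.adj_getVert_succ hi
  have hinj : ∀ i ≤ ℓ, ∀ j ≤ ℓ, w.getVert i = w.getVert j → i = j := by
    intro i hi j hj h
    rw [← hdist i hi, ← hdist j hj, h]
  have hstep : ∀ i ≤ ℓ, ∀ j ≤ ℓ, G'.Adj (w.getVert i) (w.getVert j) → j ≤ i + 1 := by
    intro i hi j hj h
    obtain ⟨q, hq⟩ := (w.take i).reachable.exists_walk_length_eq_dist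
    have h2 := SimpleGraph.dist_le (q.append h.toWalk)
    rw [SimpleGraph.Walk.length_append, hdist j hj, hq, hdist i hi] at h2
    simpa using h2
  have hiff : ∀ i ≤ ℓ, ∀ j ≤ ℓ, (G.Adj (w.getVert i) (w.getVert j) ↔ i + 1 = j ∨ j + 1 = i) := by
    intro i hi j hj
    constructor
    · intro h
      have h' : G'.Adj (w.getVert i) (w.getVert j) := by simpa [hG'] using h
      have h1 := hstep i hi j hj h'
      have h2 := hstep j hj i hi h'.symm
      have h3 : i ≠ j := by rintro rfl; exact G'.irrefl h'
      omega
    · rintro (rfl | rfl)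
      · exact hsucc i (by omega)
      · exact (hsucc j (by omega)).symm
  have h0 : ((w.getVert 0 : X) : W) = a := by simp
  have hl : ((w.getVert ℓ : X) : W) = b := by simp [hℓ]
  have hℓ2 : 2 ≤ ℓ := by
    by_contra hlt
    have : ℓ = 0 ∨ ℓ = 1 := by omega
    rcases this with h | h
    · rw [h] at hl; exact hab (h0.symm.trans hl)
    · have := (hiff 0 (by omega) ℓ le_rfl).2 (by omega)
      rw [h0, hl] at this
      exact hadj this
  have hmem : ∀ i, 0 < i → i < ℓ → ((w.getVert i : X) : W) ∈ I := by
    intro i h1 h2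
    have h := (w.getVert i).2
    rcases h with h | h | h
    · have := hinj i h2.le 0 (by omega) (Subtype.ext (h.trans h0.symm)); omega
    · have := hinj i h2.le ℓ le_rfl (Subtype.ext (h.trans hl.symm)); omega
    · exact h
  refine ⟨ℓ - 1, fun i => (w.getVert (i + 1) : X), by omega, ?_, ?_, ?_, ?_, ?_⟩
  · intro i j h
    have := hinj (i + 1) (by omega) (j + 1) (by omega) (Subtype.ext h)
    ext; omega
  · apply Set.Subset.antisymm
    · rintro _ ⟨i, rfl⟩
      exact hmem _ (by omega) (by omega)
    · intro x hx
      by_contra hxr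
      have hne : ∀ i ≤ ℓ, ((w.getVert i : X) : W) ≠ x := by
        intro i hi h
        rcases Nat.eq_zero_or_pos i with rfl | hpos
        · exact ha (h0 ▸ h ▸ hx)
        · rcases hi.lt_or_eq with hlt | rfl
          · exact hxr ⟨⟨i - 1, by omega⟩, by
              simpa [Nat.sub_add_cancel hpos] using h⟩
          · exact hb (hl ▸ h ▸ hx)
      -- If the walk missed `x`, it would survive the removal of `x`, and no separator `Q` could
      -- exist.
      obtain ⟨Q, haQ, hbQ, hQ⟩ := hmin {x} ⟨x, hx, rfl⟩
      have : ∀ i ≤ ℓ, ((w.getVert i : X) : W) ∈ Q := by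
        intro i
        induction i with
        | zero => intro _; rwa [h0]
        | succ i ih =>
          intro hi
          by_contra hnot
          exact hQ _ (w.getVert i).2 _ (w.getVert (i + 1)).2 (ih (by omega)) hnot
            (fun h => hne i (by omega) h.2) (fun h => hne _ hi h.2)
            ((hiff i (by omega) _ hi).2 (Or.inl rfl))
      exact hbQ (hl ▸ this ℓ le_rfl)
  · intro i j
    rw [hiff _ (by omega) _ (by omega)]
    omega
  · intro i
    have := hiff 0 (by omega) (i + 1) (by omega)
    rw [h0] at this
    rw [this]
    omega
  · intro i
    have := hiff ℓ le_rfl (i + 1) (by omega)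
    rw [hl] at this
    rw [this]
    omega

variable {m : ℕ} {p : Fin m → W} {a b : W}

/-- The two ends of an induced path are not separated within the path. -/
theorem exists_adj_of_inducedPath (hm : 1 ≤ m)
    (hp : ∀ i j, G.Adj (p i) (p j) ↔ (i : ℕ) + 1 = j ∨ (j : ℕ) + 1 = i)
    (ha : ∀ i, G.Adj a (p i) ↔ (i : ℕ) = 0) (hb : ∀ i, G.Adj b (p i) ↔ (i : ℕ) + 1 = m)
    {D : Set W} (haD : a ∈ D) (hbD : b ∉ D) :
    ∃ i ∈ insert a (insert b (Set.range p)), ∃ j ∈ insert a (insert b (Set.range p)),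
      i ∈ D ∧ j ∉ D ∧ G.Adj i j := by
  by_contra! hcon
  have hD : ∀ k (hk : k < m), p ⟨k, hk⟩ ∈ D := by
    intro k
    induction k with
    | zero =>
      intro hk
      by_contra h
      exact hcon a (by simp) (p ⟨0, hk⟩) (by simp) haD h ((ha _).2 rfl)
    | succ k ih =>
      intro hk
      by_contra h
      exact hcon (p ⟨k, by omega⟩) (by simp) (p ⟨k + 1, hk⟩) (by simp) (ih _) h
        ((hp _ _).2 (Or.inl rfl))
  exact hcon (p ⟨m - 1, by omega⟩) (by simp) b (by simp) (hD _ _) hbD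
    ((hb _).2 (by simp; omega)).symm

/-- Removing an internal vertex of an induced path separates its two ends. -/
theorem exists_separator_of_inducedPath (hinj : Function.Injective p) (hab : a ≠ b)
    (hadj : ¬ G.Adj a b) (haI : a ∉ Set.range p) (hbI : b ∉ Set.range p)
    (hp : ∀ i j, G.Adj (p i) (p j) ↔ (i : ℕ) + 1 = j ∨ (j : ℕ) + 1 = i)
    (ha : ∀ i, G.Adj a (p i) ↔ (i : ℕ) = 0) (hb : ∀ i, G.Adj b (p i) ↔ (i : ℕ) + 1 = m)
    {D : Set W} (hD : ∃ i ∈ Set.range p, i ∈ D) :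
    ∃ Q : Set W, a ∈ Q ∧ b ∉ Q ∧
      ∀ i ∈ insert a (insert b (Set.range p)), ∀ j ∈ insert a (insert b (Set.range p)),
        i ∈ Q → j ∉ Q → ¬ (i ∈ Set.range p ∧ i ∈ D) → ¬ (j ∈ Set.range p ∧ j ∈ D) →
        ¬ G.Adj i j := by
  -- One removed vertex `p k` suffices: `Q` consists of `a` and the path before `p k`, so an edge of
  -- the path that leaves `Q` ends in `p k`.
  obtain ⟨_, ⟨k, rfl⟩, hk⟩ := hD
  have key : ∀ i, p i ∈ insert a {x | ∃ i : Fin m, i < k ∧ p i = x} ↔ i < k := by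
    intro i
    constructor
    · rintro (h | ⟨j, hj, h⟩)
      · exact (haI ⟨i, h⟩).elim
      · rwa [← hinj h]
    · exact fun h => Or.inr ⟨i, h, rfl⟩
  have hbQ : b ∉ insert a {x | ∃ i : Fin m, i < k ∧ p i = x} := by
    rintro (h | ⟨j, hj, h⟩)
    · exact hab h.symm
    · exact hbI ⟨j, h⟩
  refine ⟨insert a {x | ∃ i : Fin m, i < k ∧ p i = x}, Or.inl rfl, hbQ, ?_⟩
  have hne : ∀ i, ¬ (p i ∈ Set.range p ∧ p i ∈ D) → i ≠ k := by
    rintro i h rfl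
    exact h ⟨⟨i, rfl⟩, hk⟩
  rintro i (rfl | rfl | ⟨i, rfl⟩) j (rfl | rfl | ⟨j, rfl⟩) hi hj hiD hjD hij
  · exact hj hi
  · exact hadj hij
  · rw [ha] at hij
    rw [key] at hj
    have := hne j hjD
    rw [ne_eq, Fin.ext_iff] at this
    rw [Fin.lt_def] at hj
    omega
  · exact hj (Or.inl rfl)
  · exact hj hi
  · exact hbQ hi
  · exact hj (Or.inl rfl)
  · rw [key] at hi
    have := (hb _).1 hij.symm
    rw [Fin.lt_def] at hi
    omega
  · rw [key] at hi hj
    have h1 := hne j hjD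
    have h2 := (hp _ _).1 hij
    rw [ne_eq, Fin.ext_iff] at h1
    rw [Fin.lt_def] at hi hj
    omega

end SimpleGraph

namespace Pathograph

/-! ### Realizations as vertex labellings -/

/-- The number of vertices of a code. -/
def numV (c : Code) : ℕ := c.1

/-- The number of urpaths of a code. -/
def numU (c : Code) : ℕ := c.2.1.length

/-- The first endpoint of the urpath `u` of a code. -/
def endA (c : Code) (u : ℕ) : ℕ := (c.2.1.getD u (0, 0)).1

/-- The second endpoint of the urpath `u` of a code. -/
def endB (c : Code) (u : ℕ) : ℕ := (c.2.1.getD u (0, 0)).2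

/-- The edges of a code. -/
def EdgeIn (c : Code) (v w : ℕ) : Prop := (v, w) ∈ c.2.2.1 ∨ (w, v) ∈ c.2.2.1

/-- The spokes of a code. -/
def SpokeIn (c : Code) (v u : ℕ) : Prop := (v, u) ∈ c.2.2.2.1

/-- The rungs of a code. -/
def RungIn (c : Code) (u u' : ℕ) : Prop := (u, u') ∈ c.2.2.2.2 ∨ (u', u) ∈ c.2.2.2.2

/-- The label `x` occurs on the path of the urpath `u` (internal vertices have the label
`numV c + u`). -/
def OnPath (c : Code) (u x : ℕ) : Prop := x = numV c + u ∨ x = endA c u ∨ x = endB c u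

section

variable {W : Type} (c : Code) (G : SimpleGraph W) (κ : W → ℕ)

/-- Some vertices with the labels `x` and `y` are adjacent. -/
def Touch (x y : ℕ) : Prop := ∃ i j, κ i = x ∧ κ j = y ∧ G.Adj i j

/-- The conditions on a labelling that involve no sets of vertices. -/
def Conforms : Prop :=
  (∀ v < numV c, ∃ i, κ i = v) ∧
  (∀ v < numV c, ∀ w < numV c, (Touch G κ v w ↔ EdgeIn c v w)) ∧
  (∀ v < numV c, ∀ u < numU c, v ≠ endA c u → v ≠ endB c u →
    (Touch G κ v (numV c + u) ↔ SpokeIn c v u)) ∧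
  (∀ u < numU c, ∀ u' < numU c, u ≠ u' →
    (Touch G κ (numV c + u) (numV c + u') ↔ RungIn c u u'))

/-- The set `D` does not split the vertices with the label of a vertex of `c`, and if it
separates the ends of an urpath, then it is left by an edge of the path. -/
def Connects (D : W → Prop) : Prop :=
  (∀ v < numV c, ¬ ((∃ i, κ i = v ∧ D i) ∧ ∃ i, κ i = v ∧ ¬ D i)) ∧
  (∀ u < numU c, (∃ i, κ i = endA c u ∧ D i) → (∃ i, κ i = endB c u ∧ ¬ D i) →
    ∃ i j, (OnPath c u (κ i) ∧ D i ∧ OnPath c u (κ j) ∧ ¬ D j) ∧ G.Adj i j)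

/-- The set `Q` separates the ends of the urpath `u` after removal of the internal vertices of
its path that lie in `D`. -/
def Separates (D : W → Prop) (u : ℕ) (Q : W → Prop) : Prop :=
  (∃ i, κ i = endA c u ∧ Q i) ∧ (∃ i, κ i = endB c u ∧ ¬ Q i) ∧
  ¬ ∃ i j, ((OnPath c u (κ i) ∧ Q i ∧ ¬ (κ i = numV c + u ∧ D i)) ∧
    OnPath c u (κ j) ∧ ¬ Q j ∧ ¬ (κ j = numV c + u ∧ D j)) ∧ G.Adj i j

/-- The labelling `κ` shows a realization of the pathograph with the code `c`. Vertices with a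
label that is at least `numV c + numU c` do not belong to it. -/
def IsModel : Prop :=
  Conforms c G κ ∧ ∀ D : W → Prop, Connects c G κ D ∧
    ∀ u < numU c, (∃ i, κ i = numV c + u ∧ D i) → ∃ Q : W → Prop, Separates c G κ D u Q

end

/-! ### Realizations as maps into a graph, and data of codes -/

section

variable {F : Pathograph} {W W' : Type} {G : SimpleGraph W}

theorem containedIn_iff : F.ContainedIn G ↔
    ∃ (m : F.U → ℕ) (g : F.V ⊕ (Σ u : F.U, Fin (m u)) → W),
      Function.Injective g ∧ F.IsSubdivision m (G.comap g) := by
  constructor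
  · rintro ⟨s, m, G', hG', ⟨e⟩⟩
    refine ⟨m, fun x => (e.symm x : W), fun x y h => e.symm.injective (Subtype.ext h), ?_⟩
    convert hG'
    ext x y
    have := e.symm.map_rel_iff (a := x) (b := y)
    simpa using this
  · rintro ⟨m, g, hg, h⟩
    refine ⟨Set.range g, m, _, h, ⟨(SimpleGraph.Iso.symm ⟨Equiv.ofInjective g hg, ?_⟩)⟩⟩
    intro x y
    simp

theorem isRealization_iff : F.IsRealization G ↔
    ∃ (m : F.U → ℕ) (g : F.V ⊕ (Σ u : F.U, Fin (m u)) → W),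
      Function.Bijective g ∧ F.IsSubdivision m (G.comap g) := by
  constructor
  · rintro ⟨m, G', hG', ⟨e⟩⟩
    refine ⟨m, e.symm, e.symm.bijective, ?_⟩
    convert hG'
    ext x y
    have := e.symm.map_rel_iff (a := x) (b := y)
    simpa using this
  · rintro ⟨m, g, hg, h⟩
    refine ⟨m, _, h, ⟨(SimpleGraph.Iso.symm ⟨Equiv.ofBijective g hg, ?_⟩)⟩⟩
    intro x y
    simp

theorem ContainedIn.of_iso {G' : SimpleGraph W'} (e : G ≃g G') (h : F.ContainedIn G) :
    F.ContainedIn G' := by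
  rw [containedIn_iff] at h ⊢
  obtain ⟨m, g, hg, h⟩ := h
  refine ⟨m, e ∘ g, e.injective.comp hg, ?_⟩
  convert h using 1
  ext x y
  exact e.map_adj_iff

theorem IsRealization.of_iso {G' : SimpleGraph W'} (e : G ≃g G') (h : F.IsRealization G) :
    F.IsRealization G' := by
  obtain ⟨m, H, hH, ⟨e'⟩⟩ := h
  exact ⟨m, H, hH, ⟨e.symm.trans e'⟩⟩

/-- The data of `IsCodeOf` with the accessors for codes. -/
theorem IsCodeOf.exists_equiv {c : Code} (h : IsCodeOf c F) :
    ∃ (eV : F.V ≃ Fin (numV c)) (eU : F.U ≃ Fin (numU c)),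
      (∀ u, (F.ends u).map (fun v => (eV v : ℕ)) = s(endA c (eU u), endB c (eU u))) ∧
      (∀ v w, F.edges.Adj v w ↔ EdgeIn c (eV v) (eV w)) ∧
      (∀ v u, F.Spoke v u ↔ SpokeIn c (eV v) (eU u)) ∧
      (∀ u u', F.rungs.Adj u u' ↔ RungIn c (eU u) (eU u')) := by
  obtain ⟨n, ends, edges, spokes, rungs⟩ := c
  obtain ⟨eV, eU, h1, h2, h3, h4⟩ := h
  refine ⟨eV, eU, fun u => ?_, h2, h3, h4⟩
  refine (h1 u).trans ?_
  have : ends.getD (eU u : ℕ) (0, 0) = ends.get (eU u) := by simp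
  exact congrArg (fun q : ℕ × ℕ => s(q.1, q.2)) this.symm

end

/-! ### Labellings correspond to subdivisions -/

section

variable {F : Pathograph} {W : Type} {G : SimpleGraph W} {c : Code}
  {eV : F.V ≃ Fin (numV c)} {eU : F.U ≃ Fin (numU c)} {m : F.U → ℕ}
  {g : F.V ⊕ (Σ u : F.U, Fin (m u)) → W} {κ : W → ℕ}

/-- No set splits a class with a vertex label, as it has one element. The cut edges and the
separators come from `SimpleGraph.exists_adj_of_inducedPath` and
`SimpleGraph.exists_separator_of_inducedPath`. -/
theorem IsSubdivision.isModel (hg : Function.Injective g)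
    (hends : ∀ u, (F.ends u).map (fun v => (eV v : ℕ)) = s(endA c (eU u), endB c (eU u)))
    (hedge : ∀ v w, F.edges.Adj v w ↔ EdgeIn c (eV v) (eV w))
    (hspoke : ∀ v u, F.Spoke v u ↔ SpokeIn c (eV v) (eU u))
    (hrung : ∀ u u', F.rungs.Adj u u' ↔ RungIn c (eU u) (eU u'))
    (hV : ∀ v i, κ i = eV v ↔ i = g (Sum.inl v))
    (hU : ∀ u i, κ i = numV c + eU u ↔ ∃ k, i = g (Sum.inr ⟨u, k⟩))
    (h : F.IsSubdivision m (G.comap g)) : IsModel c G κ := by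
  have hVs : ∀ v < numV c, ∃ x, (eV x : ℕ) = v := fun v hv => ⟨eV.symm ⟨v, hv⟩, by simp⟩
  have hUs : ∀ u < numU c, ∃ x, (eU x : ℕ) = u := fun u hu => ⟨eU.symm ⟨u, hu⟩, by simp⟩
  refine ⟨⟨?_, ?_, ?_, ?_⟩, fun D => ⟨⟨?_, ?_⟩, ?_⟩⟩
  · intro v hv
    obtain ⟨v, rfl⟩ := hVs v hv
    exact ⟨_, (hV v _).2 rfl⟩
  · intro v hv w hw
    obtain ⟨v, rfl⟩ := hVs v hv
    obtain ⟨w, rfl⟩ := hVs w hw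
    rw [← hedge, ← h.edge]
    simp [Touch, hV]
  · intro v hv u hu hva hvb
    obtain ⟨v, rfl⟩ := hVs v hv
    obtain ⟨u, rfl⟩ := hUs u hu
    have hvu : v ∉ F.ends u := by
      intro hmem
      have : (eV v : ℕ) ∈ (F.ends u).map (fun v => (eV v : ℕ)) :=
        Sym2.mem_map.2 ⟨v, hmem, rfl⟩
      rw [hends, Sym2.mem_iff] at this
      tauto
    rw [← hspoke, h.spoke v u hvu]
    simp only [Touch, hV, hU, SimpleGraph.comap_adj]
    constructor
    · rintro ⟨_, _, rfl, ⟨k, rfl⟩, hadj⟩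
      exact ⟨k, hadj⟩
    · rintro ⟨k, hadj⟩
      exact ⟨_, _, rfl, ⟨k, rfl⟩, hadj⟩
  · intro u hu u' hu' hne
    obtain ⟨u, rfl⟩ := hUs u hu
    obtain ⟨u', rfl⟩ := hUs u' hu'
    rw [← hrung, h.rung u u' (by rintro rfl; exact hne rfl)]
    simp only [Touch, hU, SimpleGraph.comap_adj]
    constructor
    · rintro ⟨_, _, ⟨k, rfl⟩, ⟨l, rfl⟩, hadj⟩
      exact ⟨k, l, hadj⟩
    · rintro ⟨k, l, hadj⟩
      exact ⟨_, _, ⟨k, rfl⟩, ⟨l, rfl⟩, hadj⟩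
  · intro v hv
    obtain ⟨v, rfl⟩ := hVs v hv
    simp [hV]
  all_goals
    intro u hu
    obtain ⟨u, rfl⟩ := hUs u hu
    obtain ⟨a, b, hab, ha, hb⟩ := h.endpoints u
    have hne : a ≠ b := by
      rintro rfl
      exact F.ends_not_isDiag u (by rw [hab]; rfl)
    have hnadj : ¬ G.Adj (g (Sum.inl a)) (g (Sum.inl b)) := by
      intro hadj
      apply F.ends_not_mem_edges u
      rw [hab, SimpleGraph.mem_edgeSet, ← h.edge]
      exact hadj
    have hAB := hends u
    rw [hab, Sym2.map_mk, Sym2.eq_iff] at hAB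
    have hgab : g (Sum.inl a) ≠ g (Sum.inl b) := fun e => hne (Sum.inl_injective (hg e))
    have hgI : ∀ v, g (Sum.inl v) ∉ Set.range (fun k => g (Sum.inr ⟨u, k⟩)) := by
      rintro v ⟨k, hk⟩
      cases hg hk
    have hpinj : Function.Injective (fun k => g (Sum.inr ⟨u, k⟩)) := by
      intro k l hkl
      have := hg hkl
      simpa using this
    have hin : ∀ i, κ i = numV c + eU u ↔ i ∈ Set.range (fun k => g (Sum.inr ⟨u, k⟩)) := by
      intro i
      rw [hU]
      exact exists_congr fun k => eq_comm
    have hon : ∀ i, OnPath c (eU u) (κ i) ↔ i ∈ insert (g (Sum.inl a)) (insert (g (Sum.inl b))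
        (Set.range (fun k => g (Sum.inr ⟨u, k⟩)))) := by
      intro i
      simp only [OnPath, hin, Set.mem_insert_iff]
      rcases hAB with ⟨h1, h2⟩ | ⟨h1, h2⟩
      · rw [← h1, ← h2, hV, hV]; tauto
      · rw [← h1, ← h2, hV, hV]; tauto
  · intro hD1 hD2
    -- The code may list the two ends in the opposite order; in that case the complement of `D` is
    -- used.
    rcases hAB with ⟨h1, h2⟩ | ⟨h1, h2⟩
    · rw [← h1] at hD1
      rw [← h2] at hD2
      simp only [hV, exists_eq_left] at hD1 hD2
      obtain ⟨i, hi, j, hj, hi', hj', hadj⟩ := SimpleGraph.exists_adj_of_inducedPath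
        (p := fun k => g (Sum.inr ⟨u, k⟩)) (G := G) (h.one_le u) (h.internal u) ha hb
        (D := {i | D i}) hD1 hD2
      exact ⟨i, j, ⟨(hon i).2 hi, hi', (hon j).2 hj, hj'⟩, hadj⟩
    · rw [← h2] at hD1
      rw [← h1] at hD2
      simp only [hV, exists_eq_left] at hD1 hD2
      obtain ⟨i, hi, j, hj, hi', hj', hadj⟩ := SimpleGraph.exists_adj_of_inducedPath
        (p := fun k => g (Sum.inr ⟨u, k⟩)) (G := G) (h.one_le u) (h.internal u) ha hb
        (D := {i | ¬ D i}) hD2 (not_not.2 hD1)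
      exact ⟨j, i, ⟨(hon j).2 hj, not_not.1 hj', (hon i).2 hi, hi'⟩, hadj.symm⟩
  · intro hD
    simp only [hin] at hD
    obtain ⟨Q, haQ, hbQ, hQ⟩ := SimpleGraph.exists_separator_of_inducedPath
        (p := fun k => g (Sum.inr ⟨u, k⟩)) (G := G) hpinj hgab hnadj (hgI a) (hgI b)
        (h.internal u) ha hb (D := {i | D i}) hD
    rcases hAB with ⟨h1, h2⟩ | ⟨h1, h2⟩
    · refine ⟨(· ∈ Q), ⟨_, (h1 ▸ hV a _).2 rfl, haQ⟩, ⟨_, (h2 ▸ hV b _).2 rfl, hbQ⟩, ?_⟩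
      rintro ⟨i, j, ⟨⟨hi, hiQ, hiD⟩, hj, hjQ, hjD⟩, hadj⟩
      rw [hin] at hiD hjD
      exact hQ i ((hon i).1 hi) j ((hon j).1 hj) hiQ hjQ hiD hjD hadj
    · refine ⟨(· ∉ Q), ⟨_, (h2 ▸ hV b _).2 rfl, hbQ⟩, ⟨_, (h1 ▸ hV a _).2 rfl, not_not.2 haQ⟩, ?_⟩
      rintro ⟨i, j, ⟨⟨hi, hiQ, hiD⟩, hj, hjQ, hjD⟩, hadj⟩
      rw [hin] at hiD hjD
      exact hQ j ((hon j).1 hj) i ((hon i).1 hi) (not_not.1 hjQ) hiQ hjD hiD hadj.symm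

/-- Labels separate the parts of the image, so only two things need the set conditions: vertex
labels occur once, and each urpath label class is an induced path by minimality. -/
theorem IsModel.exists_isSubdivision
    (hends : ∀ u, (F.ends u).map (fun v => (eV v : ℕ)) = s(endA c (eU u), endB c (eU u)))
    (hedge : ∀ v w, F.edges.Adj v w ↔ EdgeIn c (eV v) (eV w))
    (hspoke : ∀ v u, F.Spoke v u ↔ SpokeIn c (eV v) (eU u))
    (hrung : ∀ u u', F.rungs.Adj u u' ↔ RungIn c (eU u) (eU u'))
    (h : IsModel c G κ) :
    ∃ (m : F.U → ℕ) (g : F.V ⊕ (Σ u : F.U, Fin (m u)) → W), Function.Injective g ∧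
      F.IsSubdivision m (G.comap g) ∧ Set.range g = {i | κ i < numV c + numU c} := by
  obtain ⟨⟨hex, hE, hS, hR⟩, hD⟩ := h
  have hf : ∀ v, ∃ x, ∀ i, κ i = eV v ↔ i = x := by
    intro v
    obtain ⟨x, hx⟩ := hex (eV v) (eV v).2
    refine ⟨x, fun i => ⟨fun hi => ?_, fun hi => hi ▸ hx⟩⟩
    by_contra hne
    -- A second vertex with the same label would make the singleton `{x}` split the class.
    exact (hD (· = x)).1.1 (eV v) (eV v).2 ⟨⟨x, hx, rfl⟩, i, hi, hne⟩
  choose f hf using hf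
  have hfV : ∀ v, κ (f v) = eV v := fun v => (hf v _).2 rfl
  have hadj : ∀ v w, G.Adj (f v) (f w) ↔ F.edges.Adj v w := by
    intro v w
    rw [hedge, ← hE _ (eV v).2 _ (eV w).2]
    simp [Touch, hf]
  have hpath : ∀ u, ∃ a b, F.ends u = s(a, b) ∧ ∃ (m : ℕ) (p : Fin m → W), 1 ≤ m ∧
      Function.Injective p ∧ Set.range p = {i | κ i = numV c + eU u} ∧
      (∀ i j, G.Adj (p i) (p j) ↔ (i : ℕ) + 1 = j ∨ (j : ℕ) + 1 = i) ∧
      (∀ i, G.Adj (f a) (p i) ↔ (i : ℕ) = 0) ∧ (∀ i, G.Adj (f b) (p i) ↔ (i : ℕ) + 1 = m) := by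
    intro u
    obtain ⟨a, b, hab, ha, hb⟩ : ∃ a b, F.ends u = s(a, b) ∧ (eV a : ℕ) = endA c (eU u) ∧
        (eV b : ℕ) = endB c (eU u) := by
      have := hends u
      induction hu : F.ends u with
      | _ a b =>
        rw [hu, Sym2.map_mk, Sym2.eq_iff] at this
        rcases this with ⟨h1, h2⟩ | ⟨h1, h2⟩
        · exact ⟨a, b, rfl, h1, h2⟩
        · exact ⟨b, a, Sym2.eq_swap, h2, h1⟩
    have hne : a ≠ b := by
      rintro rfl
      exact F.ends_not_isDiag u (by rw [hab]; rfl)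
    have hon : ∀ i, i ∈ insert (f a) (insert (f b) {i | κ i = numV c + eU u}) ↔
        OnPath c (eU u) (κ i) := by
      intro i
      rw [OnPath, ← ha, ← hb, hf, hf]
      simp only [Set.mem_insert_iff, Set.mem_ofPred_eq]
      tauto
    refine ⟨a, b, hab, SimpleGraph.exists_inducedPath_of_minimal ?_ ?_ ?_ ?_ ?_ ?_⟩
    · intro e
      have := hfV a
      rw [e, hfV] at this
      exact hne (eV.injective (Fin.ext this.symm))
    · rw [hadj]
      have := F.ends_not_mem_edges u
      rwa [hab] at this
    · simp only [Set.mem_ofPred_eq, hfV]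
      have := (eV a).2
      omega
    · simp only [Set.mem_ofPred_eq, hfV]
      have := (eV b).2
      omega
    · intro D haD hbD
      obtain ⟨i, j, ⟨h1, h2, h3, h4⟩, h5⟩ := (hD (· ∈ D)).1.2 (eU u) (eU u).2
        ⟨f a, by rw [hfV, ha], haD⟩ ⟨f b, by rw [hfV, hb], hbD⟩
      exact ⟨i, (hon i).2 h1, j, (hon j).2 h3, h2, h4, h5⟩
    · intro D hDI
      obtain ⟨Q, ⟨i, hi, hiQ⟩, ⟨j, hj, hjQ⟩, hQ⟩ := (hD (· ∈ D)).2 (eU u) (eU u).2 hDI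
      rw [← ha, hf] at hi
      rw [← hb, hf] at hj
      subst hi hj
      refine ⟨{i | Q i}, hiQ, hjQ, fun i hi j hj hiQ hjQ hiD hjD hij => hQ ?_⟩
      exact ⟨i, j, ⟨⟨(hon i).1 hi, hiQ, hiD⟩, (hon j).1 hj, hjQ, hjD⟩, hij⟩
  choose a b hab m p hm hinj hrange hp ha hb using hpath
  have hpU : ∀ u k, κ (p u k) = numV c + eU u := by
    intro u k
    have : p u k ∈ Set.range (p u) := ⟨k, rfl⟩
    rwa [hrange] at this
  have hUp : ∀ u i, κ i = numV c + eU u → ∃ k, p u k = i := by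
    intro u i hi
    have : i ∈ Set.range (p u) := by rw [hrange]; exact hi
    exact this
  refine ⟨m, Sum.elim f (fun x => p x.1 x.2), ?_, ⟨hm, ?_, ?_, ?_, ?_, ?_⟩, ?_⟩
  · have hlt := fun v => (eV v).2
    rintro (v | ⟨u, k⟩) (w | ⟨u', l⟩) e <;> simp only [Sum.elim_inl, Sum.elim_inr] at e
    · have := congrArg κ e
      rw [hfV, hfV] at this
      rw [eV.injective (Fin.ext this)]
    · have := congrArg κ e
      rw [hfV, hpU] at this
      have := hlt v
      omega
    · have := congrArg κ e
      rw [hfV, hpU] at this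
      have := hlt w
      omega
    · have := congrArg κ e
      rw [hpU, hpU] at this
      obtain rfl := eU.injective (Fin.ext (Nat.add_left_cancel this))
      rw [hinj u e]
  · exact hadj
  · exact fun u i j => hp u i j
  · exact fun u => ⟨a u, b u, hab u, ha u, hb u⟩
  · intro v u hvu
    have hA : ∀ x : ℕ, x = endA c (eU u) ∨ x = endB c (eU u) → x ≠ eV v := by
      rintro x hx rfl
      rw [← Sym2.mem_iff, ← hends, Sym2.mem_map] at hx
      obtain ⟨w, hw, hwv⟩ := hx
      rw [eV.injective (Fin.ext hwv)] at hw
      exact hvu hw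
    rw [hspoke, ← hS _ (eV v).2 _ (eU u).2 (hA _ (Or.inl rfl)).symm (hA _ (Or.inr rfl)).symm]
    constructor
    · rintro ⟨i, j, hi, hj, hij⟩
      rw [hf] at hi
      obtain ⟨k, rfl⟩ := hUp _ _ hj
      subst hi
      exact ⟨k, hij⟩
    · rintro ⟨k, hk⟩
      exact ⟨_, _, hfV v, hpU u k, hk⟩
  · intro u u' hne
    rw [hrung, ← hR _ (eU u).2 _ (eU u').2 (fun e => hne (eU.injective (Fin.ext e)))]
    constructor
    · rintro ⟨i, j, hi, hj, hij⟩
      obtain ⟨k, rfl⟩ := hUp _ _ hi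
      obtain ⟨l, rfl⟩ := hUp _ _ hj
      exact ⟨k, l, hij⟩
    · rintro ⟨k, l, hk⟩
      exact ⟨_, _, hpU u k, hpU u' l, hk⟩
  · ext i
    constructor
    · rintro ⟨v | ⟨u, k⟩, rfl⟩
      · have := (eV v).2
        simp only [Sum.elim_inl, Set.mem_ofPred_eq, hfV]
        omega
      · have := (eU u).2
        simp only [Sum.elim_inr, Set.mem_ofPred_eq, hpU]
        omega
    · intro hi
      rcases lt_or_ge (κ i) (numV c) with hlt | hge
      · exact ⟨Sum.inl (eV.symm ⟨κ i, hlt⟩), ((hf _ i).1 (by simp)).symm⟩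
      · have hlt : κ i - numV c < numU c := by
          rw [Set.mem_ofPred_eq] at hi
          omega
        obtain ⟨k, hk⟩ := hUp (eU.symm ⟨κ i - numV c, hlt⟩) i (by simp; omega)
        exact ⟨Sum.inr ⟨_, k⟩, hk⟩

/-- Vertices outside the image get the spare label `numV c + numU c`; this accounts for the `+ 1` in
the number of labels. -/
theorem exists_labelling (eV : F.V ≃ Fin (numV c)) (eU : F.U ≃ Fin (numU c))
    (hg : Function.Injective g) :
    ∃ κ : W → ℕ, (∀ v i, κ i = eV v ↔ i = g (Sum.inl v)) ∧
      (∀ u i, κ i = numV c + eU u ↔ ∃ k, i = g (Sum.inr ⟨u, k⟩)) ∧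
      (∀ i, κ i < numV c + numU c + 1) ∧ ∀ i ∈ Set.range g, κ i < numV c + numU c := by
  set lab : F.V ⊕ (Σ u : F.U, Fin (m u)) → ℕ :=
    Sum.elim (fun v => (eV v : ℕ)) (fun x => numV c + eU x.1) with hlab
  have hlt : ∀ x, lab x < numV c + numU c := by
    rintro (v | ⟨u, k⟩)
    · have := (eV v).2
      simp only [hlab, Sum.elim_inl]
      omega
    · have := (eU u).2
      simp only [hlab, Sum.elim_inr]
      omega
  set κ := Function.extend g lab (fun _ => numV c + numU c) with hκ
  have hin : ∀ x, κ (g x) = lab x := fun x => hg.extend_apply _ _ x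
  have hout : ∀ i, i ∉ Set.range g → κ i = numV c + numU c :=
    fun i hi => Function.extend_apply' _ _ i hi
  refine ⟨κ, ?_, ?_, ?_, ?_⟩
  · intro v i
    have hv := (eV v).2
    by_cases hi : i ∈ Set.range g
    · obtain ⟨x, rfl⟩ := hi
      rw [hin, hg.eq_iff]
      rcases x with w | ⟨u, k⟩
      · simp [hlab, ← Fin.ext_iff]
      · simp only [hlab, Sum.elim_inr, reduceCtorEq, iff_false]
        omega
    · rw [hout i hi]
      exact ⟨fun h => by omega, fun h => (hi ⟨_, h.symm⟩).elim⟩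
  · intro u i
    have hu := (eU u).2
    by_cases hi : i ∈ Set.range g
    · obtain ⟨x, rfl⟩ := hi
      simp only [hin, hg.eq_iff]
      rcases x with w | ⟨u', k⟩
      · have := (eV w).2
        simp only [hlab, Sum.elim_inl, reduceCtorEq, exists_false, iff_false]
        omega
      · simp only [hlab, Sum.elim_inr, Nat.add_left_cancel_iff, ← Fin.ext_iff,
          EmbeddingLike.apply_eq_iff_eq, Sum.inr.injEq]
        constructor
        · rintro rfl
          exact ⟨k, rfl⟩
        · rintro ⟨l, hl⟩
          exact congrArg Sigma.fst hl
    · rw [hout i hi]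
      exact ⟨fun h => by omega, fun ⟨k, h⟩ => (hi ⟨_, h.symm⟩).elim⟩
  · intro i
    by_cases hi : i ∈ Set.range g
    · obtain ⟨x, rfl⟩ := hi
      rw [hin]
      have := hlt x
      omega
    · rw [hout i hi]
      omega
  · rintro _ ⟨x, rfl⟩
    rw [hin]
    exact hlt x

/-- Any sufficiently large `K` is allowed, so that one set of labels can serve several codes at
once. -/
theorem IsCodeOf.containedIn_iff_isModel (hc : IsCodeOf c F) {K : ℕ}
    (hK : numV c + numU c + 1 ≤ K) :
    F.ContainedIn G ↔ ∃ κ : W → Fin K, IsModel c G (fun i => κ i) := by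
  obtain ⟨eV, eU, h1, h2, h3, h4⟩ := hc.exists_equiv
  rw [containedIn_iff]
  constructor
  · rintro ⟨m, g, hg, h⟩
    obtain ⟨κ, hV, hU, hlt, -⟩ := exists_labelling eV eU hg
    exact ⟨fun i => ⟨κ i, (hlt i).trans_le hK⟩, h.isModel hg h1 h2 h3 h4 hV hU⟩
  · rintro ⟨κ, h⟩
    obtain ⟨m, g, hg, h, -⟩ := h.exists_isSubdivision h1 h2 h3 h4
    exact ⟨m, g, hg, h⟩

theorem IsCodeOf.isRealization_iff_isModel (hc : IsCodeOf c F) {K : ℕ}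
    (hK : numV c + numU c + 1 ≤ K) :
    F.IsRealization G ↔ ∃ κ : W → Fin K, IsModel c G (fun i => κ i) ∧
      ¬ ∃ i, numV c + numU c ≤ κ i := by
  obtain ⟨eV, eU, h1, h2, h3, h4⟩ := hc.exists_equiv
  rw [isRealization_iff]
  push Not
  constructor
  · rintro ⟨m, g, hg, h⟩
    obtain ⟨κ, hV, hU, hlt, hlt'⟩ := exists_labelling eV eU hg.1
    exact ⟨fun i => ⟨κ i, (hlt i).trans_le hK⟩, h.isModel hg.1 h1 h2 h3 h4 hV hU,
      fun i => hlt' i (hg.2 i)⟩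
  · rintro ⟨κ, h, hκ⟩
    obtain ⟨m, g, hg, h, hr⟩ := h.exists_isSubdivision h1 h2 h3 h4
    refine ⟨m, g, ⟨hg, Set.range_eq_univ.1 ?_⟩, h⟩
    rw [hr]
    exact Set.eq_univ_of_forall hκ

end

end Pathograph

namespace Pathograph

/-! ### Words, their types, and pumping -/

/-- An invariant of words of any length over the alphabet `α`. -/
abbrev WordInvariant (α T : Type) : Type := ∀ n : ℕ, (Fin n → α) → T

namespace WordInvariant

variable {α C T : Type}

/-- The invariant of a word determines the invariant of its extension by one letter. -/
def IsCongruence (t : WordInvariant α T) : Prop :=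
  ∀ ⦃n n' : ℕ⦄ ⦃w : Fin n → α⦄ ⦃w' : Fin n' → α⦄ (a : α), t n w = t n' w' →
    t (n + 1) (Fin.cons a w) = t (n' + 1) (Fin.cons a w')

/-- The invariant determines whether a word has the property `P`. -/
def Determines (t : WordInvariant α T) (P : ∀ n : ℕ, (Fin n → α) → Prop) : Prop :=
  ∀ ⦃n n' : ℕ⦄ ⦃w : Fin n → α⦄ ⦃w' : Fin n' → α⦄, t n w = t n' w' → (P n w ↔ P n' w')

/-- The set of the invariants of all colourings of a word. -/
def lift (t : WordInvariant (α × C) T) : WordInvariant α (Set T) :=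
  fun n w => {x | ∃ c : Fin n → C, t n (fun i => (w i, c i)) = x}

/-- In a shortest word for its invariant, all suffixes have different invariants, since otherwise a
longer suffix could be replaced by a shorter one. Counting the empty suffix, there are `n + 1` of
them. -/
theorem IsCongruence.exists_short [Fintype T] {t : WordInvariant α T} (ht : t.IsCongruence)
    (n : ℕ) (w : Fin n → α) : ∃ n' < Fintype.card T, ∃ w' : Fin n' → α, t n' w' = t n w := by
  classical
  have key : ∀ (n : ℕ) (w : Fin n → α), (∀ n' w', t n' w' = t n w → n ≤ n') →
      ∃ S : Finset T, S.card = n + 1 ∧ ∀ x ∈ S, ∃ n' ≤ n, ∃ w', t n' w' = x := by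
    intro n
    induction n with
    | zero => exact fun w _ => ⟨{t 0 w}, by simp, fun x hx =>
        ⟨0, le_rfl, w, (Finset.mem_singleton.1 hx).symm⟩⟩
    | succ n ih =>
      intro w hw
      have hcons : Fin.cons (w 0) (Fin.tail w) = w := Fin.cons_self_tail w
      -- The tail is again shortest: by the congruence, a shorter substitute for it would shorten
      -- `w`.
      obtain ⟨S, hS, hSn⟩ := ih (Fin.tail w) (fun n' w' h => by
        have := ht (w 0) h
        rw [hcons] at this
        have := hw _ _ this
        omega)
      -- Every invariant in `S` is attained by a word of length at most `n`, but that of `w` is not.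
      have hnot : t (n + 1) w ∉ S := by
        intro hmem
        obtain ⟨n', hn', w', h⟩ := hSn _ hmem
        have := hw _ _ h
        omega
      refine ⟨insert (t (n + 1) w) S, by rw [Finset.card_insert_of_notMem hnot, hS], ?_⟩
      intro x hx
      rcases Finset.mem_insert.1 hx with rfl | hx
      · exact ⟨n + 1, le_rfl, w, rfl⟩
      · obtain ⟨n', hn', h⟩ := hSn x hx
        exact ⟨n', by omega, h⟩
  have hex : ∃ n', ∃ w' : Fin n' → α, t n' w' = t n w := ⟨n, w, rfl⟩
  obtain ⟨w', hw'⟩ := Nat.find_spec hex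
  obtain ⟨S, hS, -⟩ := key _ w' (fun n' u hu => Nat.find_min' hex ⟨u, hu.trans hw'⟩)
  refine ⟨_, ?_, w', hw'⟩
  have := Finset.card_le_univ S
  omega

/-- The first letter keeps its colour; the colouring of the rest is exchanged for one with the same
invariant on the other word. -/
theorem IsCongruence.lift {t : WordInvariant (α × C) T} (ht : t.IsCongruence) :
    t.lift.IsCongruence := by
  have key : ∀ {n n' : ℕ} {w : Fin n → α} {w' : Fin n' → α} (a : α), t.lift n w = t.lift n' w' →
      t.lift (n + 1) (Fin.cons a w) ⊆ t.lift (n' + 1) (Fin.cons a w') := by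
    rintro n n' w w' a h _ ⟨c, rfl⟩
    have hmem : t n (fun i => (w i, Fin.tail c i)) ∈ t.lift n w := ⟨_, rfl⟩
    rw [h] at hmem
    obtain ⟨c', hc'⟩ := hmem
    refine ⟨Fin.cons (c 0) c', ?_⟩
    have := ht (a, c 0) hc'
    convert this using 2
    all_goals
      funext i
      refine Fin.cases ?_ (fun i => ?_) i <;> simp [Fin.tail]
  exact fun n n' w w' a h => Set.Subset.antisymm (key a h) (key a h.symm)

/-! ### Determined properties: connectives and quantifiers over colourings -/

section Determines

variable {t : WordInvariant α T} {P P' : ∀ n : ℕ, (Fin n → α) → Prop}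

theorem Determines.congr (h : t.Determines P) (hP : ∀ n w, P n w ↔ P' n w) : t.Determines P' :=
  fun _ _ _ _ e => (hP _ _).symm.trans ((h e).trans (hP _ _))

theorem Determines.const (p : Prop) : t.Determines (fun _ _ => p) := fun _ _ _ _ _ => Iff.rfl

theorem Determines.not (h : t.Determines P) : t.Determines (fun n w => ¬ P n w) :=
  fun _ _ _ _ e => not_congr (h e)

theorem Determines.and (h : t.Determines P) (h' : t.Determines P') :
    t.Determines (fun n w => P n w ∧ P' n w) :=
  fun _ _ _ _ e => and_congr (h e) (h' e)

theorem Determines.imp (h : t.Determines P) (h' : t.Determines P') :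
    t.Determines (fun n w => P n w → P' n w) :=
  fun _ _ _ _ e => imp_congr (h e) (h' e)

theorem Determines.iff (h : t.Determines P) (h' : t.Determines P') :
    t.Determines (fun n w => P n w ↔ P' n w) :=
  fun _ _ _ _ e => iff_congr (h e) (h' e)

theorem Determines.forall {ι : Sort*} {P : ι → ∀ n : ℕ, (Fin n → α) → Prop}
    (h : ∀ k, t.Determines (P k)) : t.Determines (fun n w => ∀ k, P k n w) :=
  fun _ _ _ _ e => forall_congr' fun k => h k e

theorem Determines.exists_colouring {t : WordInvariant (α × C) T}
    {P : ∀ n : ℕ, (Fin n → α × C) → Prop} (h : t.Determines P) :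
    t.lift.Determines (fun n w => ∃ c : Fin n → C, P n (fun i => (w i, c i))) := by
  have key : ∀ {n n' : ℕ} {w : Fin n → α} {w' : Fin n' → α}, t.lift n w = t.lift n' w' →
      (∃ c : Fin n → C, P n (fun i => (w i, c i))) →
      ∃ c : Fin n' → C, P n' (fun i => (w' i, c i)) := by
    rintro n n' w w' e ⟨c, hc⟩
    have hmem : t n (fun i => (w i, c i)) ∈ t.lift n w := ⟨_, rfl⟩
    rw [e] at hmem
    obtain ⟨c', hc'⟩ := hmem
    exact ⟨c', (h hc').2 hc⟩
  exact fun n n' w w' e => ⟨key e, key e.symm⟩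

theorem Determines.forall_colouring {t : WordInvariant (α × C) T}
    {P : ∀ n : ℕ, (Fin n → α × C) → Prop} (h : t.Determines P) :
    t.lift.Determines (fun n w => ∀ c : Fin n → C, P n (fun i => (w i, c i))) :=
  h.not.exists_colouring.not.congr fun _ _ => by push Not; rfl

/-- A property that ignores colours survives a lift as soon as some colouring exists. This brings
properties of different quantifier depth to one common invariant. -/
theorem Determines.lift [Nonempty C] {t : WordInvariant (α × C) T}
    (h : t.Determines (fun n s => P n (fun i => (s i).1))) : t.lift.Determines P :=
  h.exists_colouring.congr fun _ _ => by simp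

end Determines

/-- The letters, the pairs of consecutive letters, and the first letter of a word. -/
def factors (α : Type) : WordInvariant α (Set α × Set (α × α) × Set α) := fun n s =>
  (Set.range s, {x | ∃ i j : Fin n, (i : ℕ) + 1 = j ∧ (s i, s j) = x},
    {x | ∃ i : Fin n, (i : ℕ) = 0 ∧ s i = x})

/-- A letter put in front creates at most one new consecutive pair, with the former first letter;
hence the first letter is part of the invariant. -/
theorem isCongruence_factors : (factors α).IsCongruence := by
  intro n n' w w' a h
  have hpairs : ∀ {n : ℕ} (w : Fin n → α), {x | ∃ i j : Fin (n + 1), (i : ℕ) + 1 = j ∧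
      ((Fin.cons a w : Fin (n + 1) → α) i, (Fin.cons a w : Fin (n + 1) → α) j) = x} =
      {x | ∃ i j : Fin n, (i : ℕ) + 1 = j ∧ (w i, w j) = x} ∪
      Prod.mk a '' {x | ∃ i : Fin n, (i : ℕ) = 0 ∧ w i = x} := by
    intro n w
    ext x
    simp [Fin.exists_fin_succ, or_comm]
    grind
  have hhead : ∀ {n : ℕ} (w : Fin n → α), {x | ∃ i : Fin (n + 1), (i : ℕ) = 0 ∧
      (Fin.cons a w : Fin (n + 1) → α) i = x} = {a} := by
    intro n w
    ext x
    simp [eq_comm]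
  simp only [factors, Prod.mk.injEq] at h
  simp only [factors, hpairs, hhead, Fin.range_cons, h.1, h.2.1, h.2.2]

theorem determines_exists (Ψ : α → Prop) :
    (factors α).Determines (fun _ s => ∃ i, Ψ (s i)) := by
  intro n n' w w' h
  have h1 : Set.range w = Set.range w' := congrArg (fun x => x.1) h
  change (∃ i, Ψ (w i)) ↔ ∃ i, Ψ (w' i)
  rw [← Set.exists_range_iff (p := fun x => Ψ x), h1, Set.exists_range_iff]

end WordInvariant

/-! ### Graphs of words and their labellings -/

variable {α β : Type}

/-- The graph of a word: two positions are adjacent if their letters are adjacent in `R`, or if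
they are consecutive and their letters are linked by `L`. -/
def wordGraph (R : SimpleGraph α) (L : α → α → Prop) {n : ℕ} (w : Fin n → α) :
    SimpleGraph (Fin n) where
  Adj i j := R.Adj (w i) (w j) ∨ ((i : ℕ) + 1 = j ∧ L (w i) (w j)) ∨
    ((j : ℕ) + 1 = i ∧ L (w j) (w i))
  symm := ⟨fun i j h => by rw [R.adj_comm]; tauto⟩
  loopless := ⟨fun i h => by
    rcases h with h | h | h
    · exact R.irrefl h
    · omega
    · omega⟩

open WordInvariant

/-- An edge is either given by two letters at arbitrary positions, which are distinct because `R`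
has no loops, or by a consecutive pair of letters. -/
theorem determines_exists_adj (R : SimpleGraph α) (L : α → α → Prop) (f : β → α)
    (Φ : β → β → Prop) : (factors β).Determines
      (fun _ s => ∃ i j, Φ (s i) (s j) ∧ (wordGraph R L (fun i => f (s i))).Adj i j) := by
  intro n n' w w' h
  have key : ∀ {n : ℕ} (w : Fin n → β),
      (∃ i j, Φ (w i) (w j) ∧ (wordGraph R L (fun i => f (w i))).Adj i j) ↔
      (∃ x ∈ ((factors β) n w).1, ∃ y ∈ ((factors β) n w).1, Φ x y ∧ R.Adj (f x) (f y)) ∨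
      ∃ x ∈ ((factors β) n w).2.1, (Φ x.1 x.2 ∨ Φ x.2 x.1) ∧ L (f x.1) (f x.2) := by
    intro n w
    simp only [factors, wordGraph]
    constructor
    · rintro ⟨i, j, h, h' | h' | h'⟩
      · exact Or.inl ⟨w i, ⟨i, rfl⟩, w j, ⟨j, rfl⟩, h, h'⟩
      · exact Or.inr ⟨_, ⟨i, j, h'.1, rfl⟩, Or.inl h, h'.2⟩
      · exact Or.inr ⟨_, ⟨j, i, h'.1, rfl⟩, Or.inr h, h'.2⟩
    · rintro (⟨_, ⟨i, rfl⟩, _, ⟨j, rfl⟩, h⟩ | ⟨_, ⟨i, j, hij, rfl⟩, h | h, h'⟩)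
      · exact ⟨i, j, h.1, Or.inl h.2⟩
      · exact ⟨i, j, h, Or.inr (Or.inl ⟨hij, h'⟩)⟩
      · exact ⟨j, i, h, Or.inr (Or.inr ⟨hij, h'⟩)⟩
  exact (key w).trans (h ▸ (key w').symm)

section

variable (R : SimpleGraph α) (L : α → α → Prop) (c : Code) (f : β → α) (k : β → ℕ)

theorem determines_touch (x y : ℕ) : (factors β).Determines
    (fun _ s => Touch (wordGraph R L (fun i => f (s i))) (fun i => k (s i)) x y) :=
  (determines_exists_adj R L f (fun a b => k a = x ∧ k b = y)).congr fun _ _ => by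
    simp only [Touch, and_assoc]

theorem determines_conforms : (factors β).Determines
    (fun _ s => Conforms c (wordGraph R L (fun i => f (s i))) (fun i => k (s i))) :=
  .and (.forall fun v => .forall fun _ => determines_exists (fun a => k a = v)) <|
  .and (.forall fun _ => .forall fun _ => .forall fun _ => .forall fun _ =>
    (determines_touch R L f k _ _).iff (.const _)) <|
  .and (.forall fun _ => .forall fun _ => .forall fun _ => .forall fun _ => .forall fun _ =>
    .forall fun _ => (determines_touch R L f k _ _).iff (.const _)) <|
  .forall fun _ => .forall fun _ => .forall fun _ => .forall fun _ => .forall fun _ =>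
    (determines_touch R L f k _ _).iff (.const _)

theorem determines_connects (d : β → Prop) : (factors β).Determines
    (fun _ s => Connects c (wordGraph R L (fun i => f (s i))) (fun i => k (s i))
      (fun i => d (s i))) :=
  .and (.forall fun v => .forall fun _ => .not <| .and
    (determines_exists (fun a => k a = v ∧ d a)) (determines_exists (fun a => k a = v ∧ ¬ d a))) <|
  .forall fun u => .forall fun _ => .imp (determines_exists (fun a => k a = endA c u ∧ d a)) <|
    .imp (determines_exists (fun a => k a = endB c u ∧ ¬ d a)) <|
    determines_exists_adj R L f (fun a b => OnPath c u (k a) ∧ d a ∧ OnPath c u (k b) ∧ ¬ d b)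

theorem determines_separates (d q : β → Prop) (u : ℕ) : (factors β).Determines
    (fun _ s => Separates c (wordGraph R L (fun i => f (s i))) (fun i => k (s i))
      (fun i => d (s i)) u (fun i => q (s i))) :=
  .and (determines_exists (fun a => k a = endA c u ∧ q a)) <|
  .and (determines_exists (fun a => k a = endB c u ∧ ¬ q a)) <| .not <|
  determines_exists_adj R L f (fun a b =>
    (OnPath c u (k a) ∧ q a ∧ ¬ (k a = numV c + u ∧ d a)) ∧
    OnPath c u (k b) ∧ ¬ q b ∧ ¬ (k b = numV c + u ∧ d b))

/-- The invariant of words that determines the pathographs in the graph of the word. -/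
def pathType (β : Type) : WordInvariant β (Set (Set (Set ((β × Prop) × Prop) ×
    Set (((β × Prop) × Prop) × ((β × Prop) × Prop)) × Set ((β × Prop) × Prop)))) :=
  (factors ((β × Prop) × Prop)).lift.lift

/-- The two colours in `Prop` are the sets `D` and `Q`. The outer lift of `pathType` absorbs the
quantifier over `D`, the inner one that over `Q`. -/
theorem determines_isModel : (pathType β).Determines
    (fun _ s => IsModel c (wordGraph R L (fun i => f (s i))) (fun i => k (s i))) := by
  refine .and (.lift (.lift (determines_conforms R L c (fun b : (β × Prop) × Prop => f b.1.1) (fun b => k b.1.1)))) ?_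
  refine Determines.forall_colouring
    (P := fun n s => Connects c (wordGraph R L (fun i => f (s i).1)) (fun i => k (s i).1)
      (fun i => (s i).2) ∧ ∀ u < numU c, (∃ i, k (s i).1 = numV c + u ∧ (s i).2) →
      ∃ Q : Fin n → Prop, Separates c (wordGraph R L (fun i => f (s i).1)) (fun i => k (s i).1)
        (fun i => (s i).2) u Q) ?_
  refine .and (.lift (determines_connects R L c (fun b : (β × Prop) × Prop => f b.1.1) (fun b => k b.1.1)
    (fun b : (β × Prop) × Prop => b.1.2))) (.forall fun u => .forall fun _ => .imp (.lift (determines_exists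
      (fun b : (β × Prop) × Prop => k b.1.1 = numV c + u ∧ b.1.2))) ?_)
  exact (determines_separates R L c (fun b : (β × Prop) × Prop => f b.1.1) (fun b => k b.1.1) (fun b => b.1.2)
    (fun b => b.2) u).exists_colouring

theorem determines_exists_lt (N : ℕ) : (pathType β).Determines
    (fun _ s => ∃ i, N ≤ k (s i)) :=
  .lift (.lift (determines_exists (fun b : (β × Prop) × Prop => N ≤ k b.1.1)))

end

/-- A bound for the length of a shortest word of a given type over an alphabet with `b`
coloured letters. -/
def typeBound (b : ℕ) : ℕ := 2 ^ 2 ^ 2 ^ (2 ^ (4 * b) * (2 ^ (4 * b * (4 * b)) * 2 ^ (4 * b)))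

/-- Every graph of a word can be replaced by the graph of a short word that contains the same
pathographs, among those with bounded codes. -/
theorem exists_short_word [Fintype α] (R : SimpleGraph α) (L : α → α → Prop) (K : ℕ)
    {n : ℕ} (w : Fin n → α) :
    ∃ n' < typeBound (Fintype.card α * K), ∃ w' : Fin n' → α, ∀ c : Code,
      ((∃ κ : Fin n' → Fin K, IsModel c (wordGraph R L w') (fun i => κ i)) ↔
        ∃ κ : Fin n → Fin K, IsModel c (wordGraph R L w) (fun i => κ i)) ∧
      ((∃ κ : Fin n' → Fin K, IsModel c (wordGraph R L w') (fun i => κ i) ∧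
          ¬ ∃ i, numV c + numU c ≤ κ i) ↔
        ∃ κ : Fin n → Fin K, IsModel c (wordGraph R L w) (fun i => κ i) ∧
          ¬ ∃ i, numV c + numU c ≤ κ i) := by
  classical
  -- The third lift absorbs the quantifier over the labelling `κ`.
  have ht : (pathType (α × Fin K)).lift.IsCongruence := isCongruence_factors.lift.lift.lift
  obtain ⟨n', hn', w', h⟩ := ht.exists_short n w
  refine ⟨n', hn'.trans_le (le_of_eq ?_), w', fun c => ⟨?_, ?_⟩⟩
  -- The sets `D` and `Q` turn `b` letters into `4 * b`; the innermost factor counts the values of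
  -- `factors`, and each of the three lifts adds one power of two.
  · simp only [Fintype.card_set, Fintype.card_prod, Fintype.card_prop, Fintype.card_fin,
      typeBound]
    ring_nf
  · exact (determines_isModel R L c (fun b : α × Fin K => b.1)
      (fun b => (b.2 : ℕ))).exists_colouring h
  · exact ((determines_isModel R L c (fun b : α × Fin K => b.1) (fun b => (b.2 : ℕ))).and
      (determines_exists_lt (fun b : α × Fin K => (b.2 : ℕ)) _).not).exists_colouring h

end Pathograph

namespace Pathograph

/-! ### Realizations of pathographs without rungs are graphs of words -/

section

variable (H : Pathograph)

/-- The letters for the realizations of `H`: a vertex of `H`, or an internal vertex of the path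
of an urpath together with its neighbours among the vertices of `H`. -/
abbrev Letter : Type := H.V ⊕ (H.U × Set H.V)

/-- The adjacencies between letters that do not depend on their positions. -/
def letterGraph : SimpleGraph H.Letter where
  Adj
    | Sum.inl v, Sum.inl w => H.edges.Adj v w
    | Sum.inl v, Sum.inr x => v ∈ x.2
    | Sum.inr x, Sum.inl v => v ∈ x.2
    | Sum.inr _, Sum.inr _ => False
  symm := ⟨by
    rintro (v | x) (w | y) h
    · exact H.edges.symm.symm _ _ h
    all_goals exact h⟩
  loopless := ⟨by
    rintro (v | x) h
    · exact H.edges.irrefl h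
    · exact h⟩

/-- Two letters are linked if they belong to the same urpath. -/
def letterLink : H.Letter → H.Letter → Prop
  | Sum.inr x, Sum.inr y => x.1 = y.1
  | _, _ => False

variable {H}

/-- The vertices of `H` come first, then the paths, one block after another. -/
theorem exists_enumeration (m : H.U → ℕ) :
    ∃ (n : ℕ) (e : H.V ⊕ (Σ u : H.U, Fin (m u)) ≃ Fin n), ∀ u (i j : Fin (m u)),
      (e (Sum.inr ⟨u, i⟩) : ℕ) + 1 = e (Sum.inr ⟨u, j⟩) ↔ (i : ℕ) + 1 = j := by
  have := H.finite_V
  have := H.finite_U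
  obtain ⟨k, ⟨eV⟩⟩ := Finite.exists_equiv_fin H.V
  obtain ⟨l, ⟨eU⟩⟩ := Finite.exists_equiv_fin H.U
  let e₁ : (Σ u : H.U, Fin (m u)) ≃ Σ x : Fin l, Fin (m (eU.symm x)) :=
    (Equiv.sigmaCongrLeft' eU)
  refine ⟨_, (eV.sumCongr (e₁.trans finSigmaFinEquiv)).trans finSumFinEquiv, ?_⟩
  intro u i j
  obtain ⟨u, rfl⟩ := eU.symm.surjective u
  have he : ∀ i : Fin (m (eU.symm u)), e₁ ⟨eU.symm u, i⟩ = ⟨u, i⟩ := by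
    intro i
    apply e₁.symm.injective
    rw [Equiv.symm_apply_apply]
    rfl
  simp [he, finSigmaFinEquiv_apply]
  omega

/-- Each internal vertex carries its adjacencies to `V` in its letter, the blocks make adjacency
within a path a matter of consecutive positions, and without rungs there are no edges between paths.
Where two blocks meet, the letters are not linked. -/
theorem Rungless.exists_wordGraph (hH : H.Rungless) {W : Type} {G : SimpleGraph W}
    (h : H.IsRealization G) :
    ∃ (n : ℕ) (w : Fin n → H.Letter), Nonempty (G ≃g wordGraph H.letterGraph H.letterLink w) := by
  obtain ⟨m, G', hG', ⟨e'⟩⟩ := h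
  obtain ⟨n, e, he⟩ := exists_enumeration m
  let letter : H.V ⊕ (Σ u : H.U, Fin (m u)) → H.Letter :=
    Sum.map id (fun x => (x.1, {v | G'.Adj (Sum.inl v) (Sum.inr x)}))
  refine ⟨n, fun i => letter (e.symm i), ⟨e'.trans ⟨e, ?_⟩⟩⟩
  intro x y
  simp only [wordGraph, Equiv.symm_apply_apply]
  rcases x with v | ⟨u, i⟩ <;> rcases y with w | ⟨u', j⟩
  · simp [letter, letterGraph, letterLink, hG'.edge]
  · simp [letter, letterGraph, letterLink]
  · simp [letter, letterGraph, letterLink, G'.adj_comm]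
  · by_cases huu : u = u'
    · subst huu
      simp [letter, letterGraph, letterLink, hG'.internal, he]
    · have hnot : ¬ G'.Adj (Sum.inr ⟨u, i⟩) (Sum.inr ⟨u', j⟩) := by
        intro hadj
        have := (hG'.rung u u' huu).2 ⟨i, j, hadj⟩
        rw [hH] at this
        exact this
      simp [letter, letterGraph, letterLink, hnot, huu, Ne.symm huu]

end

/-! ### The size of a smallest solution -/

/-- A number that exceeds the number of vertices and urpaths in each of the codes. -/
def labelBound (cs : List Code) : ℕ := cs.foldr (fun c s => numV c + numU c + 1 + s) 0

theorem le_labelBound {c : Code} {cs : List Code} (h : c ∈ cs) :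
    numV c + numU c + 1 ≤ labelBound cs := by
  induction cs with
  | nil => simp at h
  | cons d cs ih =>
    have hd : labelBound (d :: cs) = numV d + numU d + 1 + labelBound cs := rfl
    rw [hd]
    rcases List.mem_cons.1 h with rfl | h
    · omega
    · have := ih h
      omega

/-- A bound for the number of vertices of a smallest realization of a rungless pathograph that
is free of a list of pathographs. -/
def sizeBound (c : Code) (cs : List Code) : ℕ :=
  typeBound ((numV c + numU c * 2 ^ numV c) * labelBound (c :: cs))

/-- The short word need not list the vertices of a realization block by block. That its graph is a
realization of `H` is itself a property preserved by the replacement. -/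
theorem Rungless.exists_small {H : Pathograph} (hH : H.Rungless) {𝓕 : List Pathograph} {c : Code}
    {cs : List Code} (hc : IsCodeOf c H) (hcs : List.Forall₂ IsCodeOf cs 𝓕)
    (h : H.HasFreeRealization 𝓕) :
    ∃ n < sizeBound c cs, ∃ G : SimpleGraph (Fin n),
      H.IsRealization G ∧ ∀ F ∈ 𝓕, ¬ F.ContainedIn G := by
  classical
  obtain ⟨W, G, hG, hF⟩ := h
  obtain ⟨n, w, ⟨e⟩⟩ := hH.exists_wordGraph hG
  have := H.finite_V
  have := H.finite_U
  have := Fintype.ofFinite H.V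
  have := Fintype.ofFinite H.U
  obtain ⟨n', hn', w', h⟩ := exists_short_word H.letterGraph H.letterLink
    (labelBound (c :: cs)) w
  refine ⟨n', hn'.trans_le (le_of_eq ?_), wordGraph H.letterGraph H.letterLink w', ?_, ?_⟩
  -- The alphabet has `numV c + numU c * 2 ^ numV c` letters.
  · obtain ⟨eV, eU, -⟩ := hc.exists_equiv
    rw [sizeBound, Fintype.card_sum, Fintype.card_prod, Fintype.card_set,
      Fintype.card_congr eV, Fintype.card_congr eU, Fintype.card_fin, Fintype.card_fin]
  · have hb := le_labelBound (List.mem_cons_self (a := c) (l := cs))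
    rw [hc.isRealization_iff_isModel hb, (h c).2, ← hc.isRealization_iff_isModel hb]
    exact hG.of_iso e
  · intro F hF𝓕 hcon
    obtain ⟨d, hd, hdF⟩ : ∃ d ∈ cs, IsCodeOf d F := by
      obtain ⟨i, hi, rfl⟩ := List.getElem_of_mem hF𝓕
      have hi' : i < cs.length := hcs.length_eq ▸ hi
      exact ⟨cs[i], List.getElem_mem _, hcs.get hi' hi⟩
    have hb := le_labelBound (List.mem_cons_of_mem c hd)
    rw [hdF.containedIn_iff_isModel hb, (h d).1, ← hdF.containedIn_iff_isModel hb] at hcon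
    exact hF F hF𝓕 (hcon.of_iso e.symm)

end Pathograph

namespace Pathograph

/-! ### Primitive recursiveness -/

section

variable {σ : Type} [Primcodable σ]

theorem primrec_pow : Primrec₂ (fun a b : ℕ => a ^ b) :=
  (Primrec.nat_rec' Primrec.snd (Primrec.const 1)
    ((Primrec.nat_mul.comp (Primrec.snd.comp Primrec.snd)
      (Primrec.fst.comp Primrec.fst)).to₂)).of_eq fun x => by
    obtain ⟨a, b⟩ := x
    induction b with
    | zero => rfl
    | succ b ih => exact (congrArg (· * a) ih).trans (pow_succ a b).symm

theorem _root_.PrimrecPred.imp {p q : σ → Prop} (hp : PrimrecPred p) (hq : PrimrecPred q) :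
    PrimrecPred fun x => p x → q x :=
  (hp.not.or hq).of_eq fun _ => imp_iff_not_or.symm

theorem _root_.PrimrecPred.iff {p q : σ → Prop} (hp : PrimrecPred p) (hq : PrimrecPred q) :
    PrimrecPred fun x => p x ↔ q x :=
  ((hp.imp hq).and (hq.imp hp)).of_eq fun _ => iff_iff_implies_and_implies.symm

theorem _root_.PrimrecPred.ball_mem {τ : Type} [Primcodable τ] {l : σ → List τ} {p : σ → τ → Prop}
    (hl : Primrec l) (hp : PrimrecPred fun y : σ × τ => p y.1 y.2) :
    PrimrecPred fun x => ∀ v ∈ l x, p x v :=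
  (PrimrecRel.forall_mem_list (R := fun v x => p x v)
    (hp.comp (Primrec.pair Primrec.snd Primrec.fst))).comp hl Primrec.id

theorem _root_.PrimrecPred.bex_mem {τ : Type} [Primcodable τ] {l : σ → List τ} {p : σ → τ → Prop}
    (hl : Primrec l) (hp : PrimrecPred fun y : σ × τ => p y.1 y.2) :
    PrimrecPred fun x => ∃ v ∈ l x, p x v :=
  (PrimrecRel.exists_mem_list (R := fun v x => p x v)
    (hp.comp (Primrec.pair Primrec.snd Primrec.fst))).comp hl Primrec.id

theorem _root_.PrimrecPred.ball_lt {n : σ → ℕ} {p : σ → ℕ → Prop} (hn : Primrec n)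
    (hp : PrimrecPred fun y : σ × ℕ => p y.1 y.2) : PrimrecPred fun x => ∀ v < n x, p x v :=
  (PrimrecPred.ball_mem (Primrec.list_range.comp hn) hp).of_eq fun _ => by simp

theorem _root_.PrimrecPred.bex_lt {n : σ → ℕ} {p : σ → ℕ → Prop} (hn : Primrec n)
    (hp : PrimrecPred fun y : σ × ℕ => p y.1 y.2) : PrimrecPred fun x => ∃ v < n x, p x v :=
  (PrimrecPred.bex_mem (Primrec.list_range.comp hn) hp).of_eq fun _ => by simp

theorem _root_.PrimrecPred.mem {τ : Type} [Primcodable τ] {l : σ → List τ} {a : σ → τ}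
    (hl : Primrec l) (ha : Primrec a) : PrimrecPred fun x => a x ∈ l x :=
  (PrimrecPred.bex_mem (p := fun x v => v = a x) hl
    (Primrec.eq.comp Primrec.snd (ha.comp Primrec.fst))).of_eq fun _ => by simp

theorem _root_.PrimrecPred.exists_fin {n : σ → ℕ} (p : σ → ℕ → Prop) (hn : Primrec n)
    (hp : PrimrecPred fun y : σ × ℕ => p y.1 y.2) :
    PrimrecPred fun x => ∃ i : Fin (n x), p x i :=
  (PrimrecPred.bex_lt hn hp).of_eq fun _ => by simp [Fin.exists_iff]

/-! ### Labellings, sets and graphs coded by digits -/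

/-- The digit of `a` with the number `i` in base `b`. -/
def digit (b a i : ℕ) : ℕ := a / b ^ i % b

theorem primrec_digit {b a i : σ → ℕ} (hb : Primrec b) (ha : Primrec a) (hi : Primrec i) :
    Primrec fun x => digit (b x) (a x) (i x) :=
  Primrec.nat_mod.comp (Primrec.nat_div.comp ha (primrec_pow.comp hb hi)) hb

theorem exists_digit {n b : ℕ} (f : Fin n → Fin b) :
    ∃ a < b ^ n, ∀ i : Fin n, digit b a i = f i := by
  refine ⟨finFunctionFinEquiv f, (finFunctionFinEquiv f).2, fun i => ?_⟩
  have := congrFun (finFunctionFinEquiv.symm_apply_apply f) i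
  rw [Fin.ext_iff] at this
  exact this

theorem digit_lt {n b a i : ℕ} (ha : a < b ^ n) (hi : i < n) : digit b a i < b := by
  apply Nat.mod_lt
  rcases Nat.eq_zero_or_pos b with rfl | h
  · rw [zero_pow (by omega)] at ha
    omega
  · exact h

/-- Functions from `Fin n` to `Fin b` are the digit sequences of the numbers below `b ^ n`, so this
quantifier becomes a bounded one over numbers. -/
theorem exists_labelling_iff {n b : ℕ} (P : (Fin n → ℕ) → Prop) :
    (∃ f : Fin n → Fin b, P (fun i => f i)) ↔ ∃ a < b ^ n, P (fun i => digit b a i) := by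
  constructor
  · rintro ⟨f, hf⟩
    obtain ⟨a, ha, h⟩ := exists_digit f
    exact ⟨a, ha, by simpa only [h] using hf⟩
  · rintro ⟨a, ha, h⟩
    exact ⟨fun i => ⟨digit b a i, digit_lt ha i.2⟩, h⟩

theorem exists_subset_iff {n : ℕ} (P : (Fin n → Prop) → Prop) :
    (∃ D : Fin n → Prop, P D) ↔ ∃ a < 2 ^ n, P (fun i => digit 2 a i = 1) := by
  classical
  constructor
  · rintro ⟨D, hD⟩
    obtain ⟨a, ha, h⟩ := exists_digit (fun i => if D i then (1 : Fin 2) else 0)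
    refine ⟨a, ha, ?_⟩
    convert hD using 2 with i
    rw [h]
    split_ifs with hi <;> simp [hi]
  · rintro ⟨a, -, h⟩
    exact ⟨_, h⟩

/-- The domain of the labelling varies with `x`, so primitive recursiveness is only asked of the
instances of `P` at labellings coded by a number. -/
theorem _root_.PrimrecPred.exists_labelling {n b : σ → ℕ} (P : ∀ x : σ, (Fin (n x) → ℕ) → Prop)
    (hn : Primrec n) (hb : Primrec b)
    (hP : PrimrecPred fun y : σ × ℕ => P y.1 (fun i => digit (b y.1) y.2 i)) :
    PrimrecPred fun x => ∃ f : Fin (n x) → Fin (b x), P x (fun i => f i) :=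
  (PrimrecPred.bex_lt (p := fun x a => P x (fun i => digit (b x) a i)) (primrec_pow.comp hb hn)
    hP).of_eq fun x => (exists_labelling_iff (P x)).symm

theorem _root_.PrimrecPred.exists_subset {n : σ → ℕ} (P : ∀ x : σ, (Fin (n x) → Prop) → Prop)
    (hn : Primrec n) (hP : PrimrecPred fun y : σ × ℕ => P y.1 (fun i => digit 2 y.2 i = 1)) :
    PrimrecPred fun x => ∃ D : Fin (n x) → Prop, P x D :=
  (PrimrecPred.bex_lt (p := fun x a => P x (fun i => digit 2 a i = 1))
    (primrec_pow.comp (.const 2) hn) hP).of_eq fun x => (exists_subset_iff (P x)).symm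

theorem _root_.PrimrecPred.forall_subset {n : σ → ℕ} (P : ∀ x : σ, (Fin (n x) → Prop) → Prop)
    (hn : Primrec n) (hP : PrimrecPred fun y : σ × ℕ => P y.1 (fun i => digit 2 y.2 i = 1)) :
    PrimrecPred fun x => ∀ D : Fin (n x) → Prop, P x D :=
  (PrimrecPred.exists_subset (fun x D => ¬ P x D) hn hP.not).not.of_eq fun _ => by
    push Not
    rfl

/-- The graph on `n` vertices whose adjacency matrix is given by the binary digits of `a`. -/
def graphOf (n a : ℕ) : SimpleGraph (Fin n) where
  Adj i j := i.1 ≠ j.1 ∧ (digit 2 a (j.1 + n * i.1) = 1 ∨ digit 2 a (i.1 + n * j.1) = 1)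
  symm := ⟨fun _ _ h => ⟨h.1.symm, h.2.symm⟩⟩
  loopless := ⟨fun _ h => h.1 rfl⟩

theorem exists_graphOf_eq {n : ℕ} (G : SimpleGraph (Fin n)) :
    ∃ a < 2 ^ (n * n), graphOf n a = G := by
  classical
  -- The digit positions follow `finProdFinEquiv`, which sends `(i, j)` to `j + n * i`.
  obtain ⟨a, ha, h⟩ := exists_digit (fun x : Fin (n * n) =>
    if G.Adj (finProdFinEquiv.symm x).1 (finProdFinEquiv.symm x).2 then (1 : Fin 2) else 0)
  have key : ∀ i j : Fin n, digit 2 a (j.1 + n * i.1) = 1 ↔ G.Adj i j := by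
    intro i j
    have := h (finProdFinEquiv (i, j))
    rw [finProdFinEquiv_apply_val, Equiv.symm_apply_apply] at this
    rw [this]
    split_ifs with hij <;> simp [hij]
  refine ⟨a, ha, ?_⟩
  ext i j
  simp only [graphOf, key]
  constructor
  · rintro ⟨-, h | h⟩
    · exact h
    · exact h.symm
  · exact fun h => ⟨fun e => h.ne (Fin.ext e), Or.inl h⟩

theorem _root_.PrimrecPred.exists_adj {n a : σ → ℕ} (p : σ → ℕ → ℕ → Prop) (hn : Primrec n)
    (ha : Primrec a) (hp : PrimrecPred fun y : (σ × ℕ) × ℕ => p y.1.1 y.1.2 y.2) :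
    PrimrecPred fun x => ∃ i j : Fin (n x), p x i j ∧ (graphOf (n x) (a x)).Adj i j := by
  have hx : Primrec fun y : (σ × ℕ) × ℕ => y.1.1 := Primrec.fst.comp Primrec.fst
  have hi : Primrec fun y : (σ × ℕ) × ℕ => y.1.2 := Primrec.snd.comp Primrec.fst
  have hj : Primrec fun y : (σ × ℕ) × ℕ => y.2 := Primrec.snd
  have hd : ∀ {i j : (σ × ℕ) × ℕ → ℕ}, Primrec i → Primrec j →
      PrimrecPred fun y : (σ × ℕ) × ℕ => digit 2 (a y.1.1) (j y + n y.1.1 * i y) = 1 :=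
    fun hi hj => Primrec.eq.comp (primrec_digit (.const 2) (ha.comp hx)
      (Primrec.nat_add.comp hj (Primrec.nat_mul.comp (hn.comp hx) hi))) (.const 1)
  exact PrimrecPred.exists_fin (fun x i => ∃ j : Fin (n x), p x i j ∧ (i ≠ j ∧
    (digit 2 (a x) (j + n x * i) = 1 ∨ digit 2 (a x) (i + n x * j) = 1))) hn
    (PrimrecPred.exists_fin (fun y j => p y.1 y.2 j ∧ (y.2 ≠ j ∧
      (digit 2 (a y.1) (j + n y.1 * y.2) = 1 ∨ digit 2 (a y.1) (y.2 + n y.1 * j) = 1)))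
      (hn.comp Primrec.fst)
      (hp.and ((Primrec.eq.comp hi hj).not.and ((hd hi hj).or (hd hj hi)))))

/-! ### Primitive recursive access to codes -/

section Codes

variable {c : σ → Code} {u v w : σ → ℕ} (hc : Primrec c) (hu : Primrec u) (hv : Primrec v)
  (hw : Primrec w)

include hc in
theorem primrec_numV : Primrec fun x => numV (c x) := Primrec.fst.comp hc

include hc in
theorem primrec_numU : Primrec fun x => numU (c x) :=
  Primrec.list_length.comp (Primrec.fst.comp (Primrec.snd.comp hc))

include hc hu in
theorem primrec_endA : Primrec fun x => endA (c x) (u x) :=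
  Primrec.fst.comp ((Primrec.list_getD (0, 0)).comp (Primrec.fst.comp (Primrec.snd.comp hc)) hu)

include hc hu in
theorem primrec_endB : Primrec fun x => endB (c x) (u x) :=
  Primrec.snd.comp ((Primrec.list_getD (0, 0)).comp (Primrec.fst.comp (Primrec.snd.comp hc)) hu)

include hc hv hw in
theorem primrecPred_edgeIn : PrimrecPred fun x => EdgeIn (c x) (v x) (w x) :=
  .or (.mem (Primrec.fst.comp (Primrec.snd.comp (Primrec.snd.comp hc))) (hv.pair hw))
    (.mem (Primrec.fst.comp (Primrec.snd.comp (Primrec.snd.comp hc))) (hw.pair hv))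

include hc hv hw in
theorem primrecPred_spokeIn : PrimrecPred fun x => SpokeIn (c x) (v x) (w x) :=
  .mem (Primrec.fst.comp (Primrec.snd.comp (Primrec.snd.comp (Primrec.snd.comp hc))))
    (hv.pair hw)

include hc hv hw in
theorem primrecPred_rungIn : PrimrecPred fun x => RungIn (c x) (v x) (w x) :=
  .or (.mem (Primrec.snd.comp (Primrec.snd.comp (Primrec.snd.comp (Primrec.snd.comp hc))))
      (hv.pair hw))
    (.mem (Primrec.snd.comp (Primrec.snd.comp (Primrec.snd.comp (Primrec.snd.comp hc))))
      (hw.pair hv))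

include hc hu in
theorem primrec_numV_add : Primrec fun x => numV (c x) + u x :=
  Primrec.nat_add.comp (primrec_numV hc) hu

include hc hu hv in
theorem primrecPred_onPath : PrimrecPred fun x => OnPath (c x) (u x) (v x) :=
  .or (Primrec.eq.comp hv (primrec_numV_add hc hu)) <|
  .or (Primrec.eq.comp hv (primrec_endA hc hu)) (Primrec.eq.comp hv (primrec_endB hc hu))

end Codes

/-! ### The conditions on coded labellings are primitive recursive -/

section Models

variable {c : σ → Code} {n a b k d q u v w : σ → ℕ} (hc : Primrec c) (hn : Primrec n)
  (ha : Primrec a) (hb : Primrec b) (hk : Primrec k) (hd : Primrec d) (hq : Primrec q)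
  (hu : Primrec u) (hv : Primrec v) (hw : Primrec w)

include hn ha hb hk hv hw in
theorem primrecPred_touch : PrimrecPred fun x =>
    Touch (graphOf (n x) (a x)) (fun i => digit (b x) (k x) i) (v x) (w x) := by
  have hx : Primrec fun y : (σ × ℕ) × ℕ => y.1.1 := Primrec.fst.comp Primrec.fst
  refine (PrimrecPred.exists_adj (fun x i j => digit (b x) (k x) i = v x ∧
    digit (b x) (k x) j = w x) hn ha (.and ?_ ?_)).of_eq fun x => ?_
  · exact Primrec.eq.comp (primrec_digit (hb.comp hx) (hk.comp hx)
      (Primrec.snd.comp Primrec.fst)) (hv.comp hx)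
  · exact Primrec.eq.comp (primrec_digit (hb.comp hx) (hk.comp hx) Primrec.snd) (hw.comp hx)
  · simp only [Touch, and_assoc]

include hn hb hk hv in
theorem primrecPred_exists_label : PrimrecPred fun x =>
    ∃ i : Fin (n x), digit (b x) (k x) i = v x :=
  PrimrecPred.exists_fin (fun x i => digit (b x) (k x) i = v x) hn
    (Primrec.eq.comp (primrec_digit (hb.comp .fst) (hk.comp .fst) .snd) (hv.comp .fst))

include hn hb hk hv hd in
theorem primrecPred_exists_label_and : PrimrecPred fun x =>
    ∃ i : Fin (n x), digit (b x) (k x) i = v x ∧ digit 2 (d x) i = 1 :=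
  PrimrecPred.exists_fin (fun x i => digit (b x) (k x) i = v x ∧ digit 2 (d x) i = 1) hn
    (.and (Primrec.eq.comp (primrec_digit (hb.comp .fst) (hk.comp .fst) .snd) (hv.comp .fst))
      (Primrec.eq.comp (primrec_digit (.const 2) (hd.comp .fst) .snd) (.const 1)))

include hn hb hk hv hd in
theorem primrecPred_exists_label_and_not : PrimrecPred fun x =>
    ∃ i : Fin (n x), digit (b x) (k x) i = v x ∧ ¬ digit 2 (d x) i = 1 :=
  PrimrecPred.exists_fin (fun x i => digit (b x) (k x) i = v x ∧ ¬ digit 2 (d x) i = 1) hn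
    (.and (Primrec.eq.comp (primrec_digit (hb.comp .fst) (hk.comp .fst) .snd) (hv.comp .fst))
      (Primrec.eq.comp (primrec_digit (.const 2) (hd.comp .fst) .snd) (.const 1)).not)

include hc hn ha hb hk in
theorem primrecPred_conforms : PrimrecPred fun x =>
    Conforms (c x) (graphOf (n x) (a x)) (fun i => digit (b x) (k x) i) := by
  have h1 : Primrec fun y : σ × ℕ => y.1 := Primrec.fst
  have h2 : Primrec fun y : (σ × ℕ) × ℕ => y.1.1 := Primrec.fst.comp Primrec.fst
  have hv : Primrec fun y : (σ × ℕ) × ℕ => y.1.2 := Primrec.snd.comp Primrec.fst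
  have hw : Primrec fun y : (σ × ℕ) × ℕ => y.2 := Primrec.snd
  have ht : ∀ {v w : (σ × ℕ) × ℕ → ℕ}, Primrec v → Primrec w → PrimrecPred fun y =>
      Touch (graphOf (n y.1.1) (a y.1.1)) (fun i => digit (b y.1.1) (k y.1.1) i) (v y) (w y) :=
    primrecPred_touch (hn.comp h2) (ha.comp h2) (hb.comp h2) (hk.comp h2)
  refine .and (.ball_lt (primrec_numV hc) (primrecPred_exists_label (hn.comp h1) (hb.comp h1)
    (hk.comp h1) .snd)) <| .and (.ball_lt (primrec_numV hc) <|
      .ball_lt (primrec_numV (hc.comp h1)) ?_) <| .and (.ball_lt (primrec_numV hc) <|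
      .ball_lt (primrec_numU (hc.comp h1)) ?_) <| .ball_lt (primrec_numU hc) <|
      .ball_lt (primrec_numU (hc.comp h1)) ?_
  · exact .iff (ht hv hw) (primrecPred_edgeIn (hc.comp h2) hv hw)
  · exact .imp (Primrec.eq.comp hv (primrec_endA (hc.comp h2) hw)).not <|
      .imp (Primrec.eq.comp hv (primrec_endB (hc.comp h2) hw)).not <|
      .iff (ht hv (primrec_numV_add (hc.comp h2) hw)) (primrecPred_spokeIn (hc.comp h2) hv hw)
  · exact .imp (Primrec.eq.comp hv hw).not <|
      .iff (ht (primrec_numV_add (hc.comp h2) hv) (primrec_numV_add (hc.comp h2) hw))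
      (primrecPred_rungIn (hc.comp h2) hv hw)

include hc hn ha hb hk hd in
theorem primrecPred_connects : PrimrecPred fun x =>
    Connects (c x) (graphOf (n x) (a x)) (fun i => digit (b x) (k x) i)
      (fun i => digit 2 (d x) i = 1) := by
  have h1 : Primrec fun y : σ × ℕ => y.1 := Primrec.fst
  have h3 : Primrec fun y : ((σ × ℕ) × ℕ) × ℕ => y.1.1.1 := Primrec.fst.comp (.comp .fst .fst)
  have hu : Primrec fun y : ((σ × ℕ) × ℕ) × ℕ => y.1.1.2 := Primrec.snd.comp (.comp .fst .fst)
  have hi : Primrec fun y : ((σ × ℕ) × ℕ) × ℕ => y.1.2 := Primrec.snd.comp Primrec.fst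
  have hj : Primrec fun y : ((σ × ℕ) × ℕ) × ℕ => y.2 := Primrec.snd
  have hon : ∀ {i : ((σ × ℕ) × ℕ) × ℕ → ℕ}, Primrec i → PrimrecPred fun y =>
      OnPath (c y.1.1.1) y.1.1.2 (digit (b y.1.1.1) (k y.1.1.1) (i y)) :=
    fun hi => primrecPred_onPath (hc.comp h3) hu (primrec_digit (hb.comp h3) (hk.comp h3) hi)
  have hD : ∀ {i : ((σ × ℕ) × ℕ) × ℕ → ℕ}, Primrec i → PrimrecPred fun y =>
      digit 2 (d y.1.1.1) (i y) = 1 :=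
    fun hi => Primrec.eq.comp (primrec_digit (.const 2) (hd.comp h3) hi) (.const 1)
  refine .and (.ball_lt (primrec_numV hc) (.not (.and
    (primrecPred_exists_label_and (hn.comp h1) (hb.comp h1) (hk.comp h1) (hd.comp h1) .snd)
    (primrecPred_exists_label_and_not (hn.comp h1) (hb.comp h1) (hk.comp h1) (hd.comp h1) .snd))))
    (.ball_lt (primrec_numU hc) <|
    .imp (primrecPred_exists_label_and (hn.comp h1) (hb.comp h1) (hk.comp h1) (hd.comp h1)
      (primrec_endA (hc.comp h1) .snd)) <|
    .imp (primrecPred_exists_label_and_not (hn.comp h1) (hb.comp h1) (hk.comp h1) (hd.comp h1)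
      (primrec_endB (hc.comp h1) .snd)) <|
    PrimrecPred.exists_adj (fun y i j => OnPath (c y.1) y.2 (digit (b y.1) (k y.1) i) ∧
      digit 2 (d y.1) i = 1 ∧ OnPath (c y.1) y.2 (digit (b y.1) (k y.1) j) ∧
      ¬ digit 2 (d y.1) j = 1) (hn.comp h1) (ha.comp h1) ?_)
  exact .and (hon hi) (.and (hD hi) (.and (hon hj) (hD hj).not))

include hc hn ha hb hk hd hq hu in
theorem primrecPred_separates : PrimrecPred fun x =>
    Separates (c x) (graphOf (n x) (a x)) (fun i => digit (b x) (k x) i)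
      (fun i => digit 2 (d x) i = 1) (u x) (fun i => digit 2 (q x) i = 1) := by
  have h2 : Primrec fun y : (σ × ℕ) × ℕ => y.1.1 := Primrec.fst.comp .fst
  have hi : Primrec fun y : (σ × ℕ) × ℕ => y.1.2 := Primrec.snd.comp Primrec.fst
  have hj : Primrec fun y : (σ × ℕ) × ℕ => y.2 := Primrec.snd
  have hκ : ∀ {i : (σ × ℕ) × ℕ → ℕ}, Primrec i → Primrec fun y =>
      digit (b y.1.1) (k y.1.1) (i y) := primrec_digit (hb.comp h2) (hk.comp h2)
  have hD : ∀ {d : σ → ℕ} {i : (σ × ℕ) × ℕ → ℕ}, Primrec d → Primrec i → PrimrecPred fun y =>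
      digit 2 (d y.1.1) (i y) = 1 :=
    fun hd hi => Primrec.eq.comp (primrec_digit (.const 2) (hd.comp h2) hi) (.const 1)
  have hnot : ∀ {i : (σ × ℕ) × ℕ → ℕ}, Primrec i → PrimrecPred fun y =>
      ¬ (digit (b y.1.1) (k y.1.1) (i y) = numV (c y.1.1) + u y.1.1 ∧
        digit 2 (d y.1.1) (i y) = 1) :=
    fun hi => .not (.and (Primrec.eq.comp (hκ hi) (primrec_numV_add (hc.comp h2) (hu.comp h2)))
      (hD hd hi))
  refine .and (primrecPred_exists_label_and hn hb hk hq (primrec_endA hc hu)) <|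
    .and (primrecPred_exists_label_and_not hn hb hk hq (primrec_endB hc hu)) <| .not <|
    PrimrecPred.exists_adj (fun x i j => (OnPath (c x) (u x) (digit (b x) (k x) i) ∧
      digit 2 (q x) i = 1 ∧ ¬ (digit (b x) (k x) i = numV (c x) + u x ∧ digit 2 (d x) i = 1)) ∧
      OnPath (c x) (u x) (digit (b x) (k x) j) ∧ ¬ digit 2 (q x) j = 1 ∧
      ¬ (digit (b x) (k x) j = numV (c x) + u x ∧ digit 2 (d x) j = 1)) hn ha ?_
  exact .and (.and (primrecPred_onPath (hc.comp h2) (hu.comp h2) (hκ hi))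
    (.and (hD hq hi) (hnot hi))) (.and (primrecPred_onPath (hc.comp h2) (hu.comp h2) (hκ hj))
    (.and (hD hq hj).not (hnot hj)))

include hc hn ha hb hk in
theorem primrecPred_isModel : PrimrecPred fun x =>
    IsModel (c x) (graphOf (n x) (a x)) (fun i => digit (b x) (k x) i) := by
  have h1 : Primrec fun y : σ × ℕ => y.1 := Primrec.fst
  have h2 : Primrec fun y : (σ × ℕ) × ℕ => y.1.1 := Primrec.fst.comp .fst
  have h3 : Primrec fun y : ((σ × ℕ) × ℕ) × ℕ => y.1.1.1 := Primrec.fst.comp (.comp .fst .fst)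
  refine .and (primrecPred_conforms hc hn ha hb hk) (PrimrecPred.forall_subset (fun x D =>
    Connects (c x) (graphOf (n x) (a x)) (fun i => digit (b x) (k x) i) D ∧
    ∀ u < numU (c x), (∃ i : Fin (n x), digit (b x) (k x) i = numV (c x) + u ∧ D i) →
      ∃ Q : Fin (n x) → Prop, Separates (c x) (graphOf (n x) (a x))
        (fun i => digit (b x) (k x) i) D u Q) hn ?_)
  refine .and (primrecPred_connects (hc.comp h1) (hn.comp h1) (ha.comp h1) (hb.comp h1)
    (hk.comp h1) .snd) (.ball_lt (primrec_numU (hc.comp h1)) (.imp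
    (primrecPred_exists_label_and (hn.comp h2) (hb.comp h2) (hk.comp h2) (.comp .snd .fst)
      (primrec_numV_add (hc.comp h2) .snd)) (PrimrecPred.exists_subset (fun y Q =>
      Separates (c y.1.1) (graphOf (n y.1.1) (a y.1.1)) (fun i => digit (b y.1.1) (k y.1.1) i)
        (fun i => digit 2 y.1.2 i = 1) y.2 Q) (hn.comp h2) ?_)))
  exact primrecPred_separates (hc.comp h3) (hn.comp h3) (ha.comp h3) (hb.comp h3) (hk.comp h3)
    (.comp .snd (.comp .fst .fst)) .snd (.comp .snd .fst)

end Models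

end

/-! ### The bounded search -/

/-- The number of labels that are needed for the code `c`. -/
def numLabels (c : Code) : ℕ := numV c + numU c + 1

theorem primrec_numLabels : Primrec numLabels :=
  Primrec.succ.comp (Primrec.nat_add.comp (primrec_numV .id) (primrec_numU .id))

theorem primrec_labelBound : Primrec labelBound :=
  Primrec.list_foldr (h := fun _ p => numV p.1 + numU p.1 + 1 + p.2) .id (.const 0)
    (Primrec.nat_add.comp (primrec_numLabels.comp (.comp .fst .snd)) (.comp .snd .snd))

theorem primrec_typeBound : Primrec typeBound := by
  have hp : ∀ {f : ℕ → ℕ}, Primrec f → Primrec fun b => 2 ^ f b :=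
    fun hf => primrec_pow.comp (.const 2) hf
  have h4 : Primrec fun b => 4 * b := Primrec.nat_mul.comp (.const 4) .id
  exact hp (hp (hp (Primrec.nat_mul.comp (hp h4)
    (Primrec.nat_mul.comp (hp (Primrec.nat_mul.comp h4 h4)) (hp h4)))))

theorem primrec_sizeBound : Primrec₂ sizeBound :=
  primrec_typeBound.comp (Primrec.nat_mul.comp (Primrec.nat_add.comp (primrec_numV .fst)
    (Primrec.nat_mul.comp (primrec_numU .fst) (primrec_pow.comp (.const 2) (primrec_numV .fst))))
    (primrec_labelBound.comp (Primrec.list_cons.comp .fst .snd)))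

/-- Some graph with fewer than `sizeBound` vertices is a realization of the pathograph with the
first code and contains none of the other pathographs. -/
def HasSmallSolution (x : Code × List Code) : Prop :=
  ∃ n < sizeBound x.1 x.2, ∃ a < 2 ^ (n * n),
    (∃ κ : Fin n → Fin (numLabels x.1), IsModel x.1 (graphOf n a) (fun i => κ i) ∧
      ¬ ∃ i, numV x.1 + numU x.1 ≤ κ i) ∧
    ∀ c ∈ x.2, ¬ ∃ κ : Fin n → Fin (numLabels c), IsModel c (graphOf n a) (fun i => κ i)

theorem primrecPred_hasSmallSolution : PrimrecPred HasSmallSolution := by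
  refine .bex_lt primrec_sizeBound <| .bex_lt
    (n := fun y : (Code × List Code) × ℕ => 2 ^ (y.2 * y.2))
    (primrec_pow.comp (.const 2) (Primrec.nat_mul.comp .snd .snd)) <| .and ?_ <|
    .ball_mem (l := fun y : ((Code × List Code) × ℕ) × ℕ => y.1.1.2)
    (.comp .snd (.comp .fst .fst)) (.not ?_)
  · have hc : Primrec fun y : (((Code × List Code) × ℕ) × ℕ) × ℕ => y.1.1.1.1 :=
      .comp .fst (.comp .fst (.comp .fst .fst))
    have hn : Primrec fun y : (((Code × List Code) × ℕ) × ℕ) × ℕ => y.1.1.2 :=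
      .comp .snd (.comp .fst .fst)
    refine PrimrecPred.exists_labelling (fun y κ => IsModel y.1.1.1 (graphOf y.1.2 y.2) κ ∧
      ¬ ∃ i, numV y.1.1.1 + numU y.1.1.1 ≤ κ i) (.comp .snd .fst)
      (primrec_numLabels.comp (.comp .fst (.comp .fst .fst)))
      (.and (primrecPred_isModel hc hn (.comp .snd .fst) (primrec_numLabels.comp hc) .snd)
      (.not (PrimrecPred.exists_fin (fun y i => numV y.1.1.1.1 + numU y.1.1.1.1 ≤
        digit (numLabels y.1.1.1.1) y.2 i) hn ?_)))
    exact Primrec.nat_le.comp (Primrec.nat_add.comp (primrec_numV (hc.comp .fst))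
      (primrec_numU (hc.comp .fst))) (primrec_digit (primrec_numLabels.comp (hc.comp .fst))
      (.comp .snd .fst) .snd)
  · exact PrimrecPred.exists_labelling
      (fun (y : (((Code × List Code) × ℕ) × ℕ) × Code) κ => IsModel y.2 (graphOf y.1.1.2 y.1.2) κ)
      (.comp .snd (.comp .fst .fst)) (primrec_numLabels.comp .snd)
      (primrecPred_isModel (.comp .snd .fst) (.comp .snd (.comp .fst (.comp .fst .fst)))
        (.comp .snd (.comp .fst .fst)) (primrec_numLabels.comp (.comp .snd .fst)) .snd)

/-- The size bound matters only for completeness; a graph found by the search is a solution whatever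
its size. The search gives each code its own number of labels, whereas the bound uses a common one;
both are large enough for the labelling criterion. -/
theorem Rungless.hasSmallSolution_iff {H : Pathograph} {𝓕 : List Pathograph} {c : Code}
    {cs : List Code} (hH : H.Rungless) (hc : IsCodeOf c H) (hcs : List.Forall₂ IsCodeOf cs 𝓕) :
    HasSmallSolution (c, cs) ↔ H.HasFreeRealization 𝓕 := by
  constructor
  · rintro ⟨n, -, a, -, h1, h2⟩
    refine ⟨Fin n, graphOf n a, (hc.isRealization_iff_isModel le_rfl).2 h1, fun F hF => ?_⟩
    obtain ⟨i, hi, rfl⟩ := List.getElem_of_mem hF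
    have hi' : i < cs.length := hcs.length_eq ▸ hi
    exact fun hcon => h2 _ (List.getElem_mem hi')
      (((hcs.get hi' hi).containedIn_iff_isModel le_rfl).1 hcon)
  · intro h
    obtain ⟨n, hn, G, h1, h2⟩ := hH.exists_small hc hcs h
    obtain ⟨a, ha, rfl⟩ := exists_graphOf_eq G
    refine ⟨n, hn, a, ha, (hc.isRealization_iff_isModel le_rfl).1 h1, fun d hd => ?_⟩
    obtain ⟨i, hi, rfl⟩ := List.getElem_of_mem hd
    have hi' : i < 𝓕.length := hcs.length_eq ▸ hi
    exact fun hcon => h2 _ (List.getElem_mem hi')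
      (((hcs.get hi hi').containedIn_iff_isModel le_rfl).2 hcon)

end Pathograph

theorem theorem3 :
    ∃ decider : Pathograph.Code × List Pathograph.Code → Bool,
      Computable decider ∧
      ∀ (H : Pathograph) (𝓕 : List Pathograph)
        (c : Pathograph.Code) (cs : List Pathograph.Code),
        H.Rungless →
        Pathograph.IsCodeOf c H →
        List.Forall₂ Pathograph.IsCodeOf cs 𝓕 →
        (decider (c, cs) = true ↔ H.HasFreeRealization 𝓕) := by
  -- The decision procedure `hdec` contained in the primitive recursive predicate is the instance
  -- behind `decide`.
  obtain ⟨hdec, hprim⟩ := Pathograph.primrecPred_hasSmallSolution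
  refine ⟨fun x => decide (Pathograph.HasSmallSolution x), hprim.to_comp, ?_⟩
  intro H 𝓕 c cs hH hc hcs
  rw [decide_eq_true_iff]
  exact hH.hasSmallSolution_iff hc hcs
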